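/- Let $d\in\mathbb{N}=\{1,2,\dots\}$, $\mathfrak{N}\in\mathbb{N}_0=\{0,1,2,\dots\}$, $T,L\in[0,\infty)$, $\xi\in\mathbb{R}^d$, $\Theta=\bigcup_{n=1}^\infty\mathbb{Z}^n$, let $\|\cdot\|$ be an arbitrary norm on $\mathbb{R}^d$, let $(S,\mathcal{S})$ be a measurable space, and let $F\colon\mathbb{R}^d\times S\to\mathbb{R}^d$ be $(\mathcal{B}(\mathbb{R}^d)\otimes\mathcal{S})/\mathcal{B}(\mathbb{R}^d)$-measurable with $\|F(x,s)-F(y,s)\|\le L\|x-y\|$ for all $x,y\in\mathbb{R}^d$, $s\in S$. Let $(\Omega,\mathcal{F},\mathbb{P})$ be a probability space, let $Z^\theta\colon\Omega\to S$, $\theta\in\Theta$, be i.i.d. random variables with $\mathbb{E}[\|F(\xi,Z^0)\|^2]<\infty$, let $\mathfrak{r}^\theta\colon\Omega\to[0,1]$, $\theta\in\Theta$, be independent random variables that are uniformly distributed on $[0,1]$, and assume that the families $(\mathfrak{r}^\theta)_{\theta\in\Theta}$ and $(Z^\theta)_{\theta\in\Theta}$ are independent. Let $\mathcal{X}^\theta_{n,m}\colon[0,T]\times\Omega\to\mathbb{R}^d$,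 $n\in\mathbb{N}_0$, $m\in\mathbb{N}$, $\theta\in\Theta$, be the multilevel Picard (MLP) approximations given for all $t\in[0,T]$ by $$\mathcal{X}^\theta_{n,m}(t)=\sum_{l=1}^{n-1}\frac{t}{m^{n-l}}\sum_{k=1}^{m^{n-l}}\Big(F\big(\mathcal{X}^{(\theta,l,k)}_{l,m}(\mathfrak{r}^{(\theta,l,k)}t),Z^{(\theta,l,k)}\big)-F\big(\mathcal{X}^{(\theta,l,-k)}_{l-1,m}(\mathfrak{r}^{(\theta,l,k)}t),Z^{(\theta,l,k)}\big)\Big)+\frac{t\,\mathbb{1}_{\mathbb{N}}(n)}{m^n}\sum_{k=1}^{m^n}F\big(\xi,Z^{(\theta,0,k)}\big)+\xi .$$ Let $(RV_{n,m})_{n\in\mathbb{N}_0,m\in\mathbb{N}}\subseteq\mathbb{N}_0$ (the number of realizations of the random variables $Z^\theta$ used for one realization of $\mathcal{X}^0_{n,m}(T)$) satisfy for all $n,m\in\mathbb{N}$ that $RV_{0,m}=0$ and $$RV_{n,m}\le m^n+\sum_{l=1}^{n-1}m^{n-l}\,(1+RV_{l,m}+RV_{l-1,m}).$$ Then the following holds.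 (i) There exists a unique $X\in C([0,T],\mathbb{R}^d)$ such that $X(t)=\xi+\int_0^t\mathbb{E}[F(X(r),Z^0)]\,dr$ for all $t\in[0,T]$ (and for every $Y\in C([0,T],\mathbb{R}^d)$ the expectations $\mathbb{E}[F(Y(r),Z^0)]$, $r\in[0,T]$, exist and are integrable in $r$ over $[0,T]$). (ii) There exist $c=(c_\delta)_{\delta\in(0,\infty)}\colon(0,\infty)\to[0,\infty)$ and $N=(N_\varepsilon)_{\varepsilon\in(0,1]}\colon(0,1]\to\mathbb{N}$ such that for all $\delta\in(0,\infty)$, $\varepsilon\in(0,1]$, $$\sum_{n=1}^{N_\varepsilon+\mathfrak{N}}RV_{n,n}\le c_\delta\,\varepsilon^{-(2+\delta)}\qquad\text{and}\qquad\sup_{n\in\mathbb{N},\,n\ge N_\varepsilon}\big(\mathbb{E}\big[\|X(T)-\mathcal{X}^0_{n,n}(T)\|^2\big]\big)^{1/2}\le\varepsilon .$$ -/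

import Mathlib

open MeasureTheory ProbabilityTheory

namespace MLP

/-- The index set `Θ = ⋃_{n ≥ 1} ℤⁿ` of nonempty finite tuples of integers. -/
abbrev Index : Type := {θ : List ℤ // θ ≠ []}

/-- The index `0 ∈ ℤ¹ ⊆ Θ`. -/
def Index.zero : Index := ⟨[0], by simp⟩

/-- The index `(θ, l, k) ∈ Θ` obtained from `θ ∈ Θ` by appending the integers `l` and `k`. -/
def Index.child (θ : Index) (l k : ℤ) : Index := ⟨θ.1 ++ [l, k], by simp⟩

/-- The multilevel Picard approximation `𝒳^θ_{n,m}(t)`, as a random variable on `Ω`, for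
the initial value `ξ`, the integrand `F`, the samples `Z` and the random times `r`.
The sums over `attach` range over `l = 1, …, n - 1`; see `approx_eq` for the usual form. -/
noncomputable def approx {d : ℕ} {S Ω : Type*}
    (F : EuclideanSpace ℝ (Fin d) → S → EuclideanSpace ℝ (Fin d))
    (ξ : EuclideanSpace ℝ (Fin d)) (Z : Index → Ω → S) (r : Index → Ω → ℝ)
    (n m : ℕ) (θ : Index) (t : ℝ) (ω : Ω) : EuclideanSpace ℝ (Fin d) :=
  (∑ l ∈ (Finset.Ico 1 n).attach,
      (t / (m : ℝ) ^ (n - l.1)) • ∑ k ∈ Finset.Icc 1 (m ^ (n - l.1)),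
        (F (approx F ξ Z r l.1 m (θ.child l.1 k) (r (θ.child l.1 k) ω * t) ω)
            (Z (θ.child l.1 k) ω)
          - F (approx F ξ Z r (l.1 - 1) m (θ.child l.1 (-k)) (r (θ.child l.1 k) ω * t) ω)
            (Z (θ.child l.1 k) ω)))
    + ((if 1 ≤ n then t else 0) / (m : ℝ) ^ n) •
        (∑ k ∈ Finset.Icc 1 (m ^ n), F ξ (Z (θ.child 0 k) ω))
    + ξ
termination_by n
decreasing_by
  all_goals
    have h := Finset.mem_Ico.1 l.2
    omega

/-- The defining recursion of the multilevel Picard approximations. -/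
theorem approx_eq {d : ℕ} {S Ω : Type*}
    (F : EuclideanSpace ℝ (Fin d) → S → EuclideanSpace ℝ (Fin d))
    (ξ : EuclideanSpace ℝ (Fin d)) (Z : Index → Ω → S) (r : Index → Ω → ℝ)
    (n m : ℕ) (θ : Index) (t : ℝ) (ω : Ω) :
    approx F ξ Z r n m θ t ω =
      (∑ l ∈ Finset.Ico 1 n,
        (t / (m : ℝ) ^ (n - l)) • ∑ k ∈ Finset.Icc 1 (m ^ (n - l)),
          (F (approx F ξ Z r l m (θ.child l k) (r (θ.child l k) ω * t) ω)
              (Z (θ.child l k) ω)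
            - F (approx F ξ Z r (l - 1) m (θ.child l (-k)) (r (θ.child l k) ω * t) ω)
              (Z (θ.child l k) ω)))
      + ((if 1 ≤ n then t else 0) / (m : ℝ) ^ n) •
          (∑ k ∈ Finset.Icc 1 (m ^ n), F ξ (Z (θ.child 0 k) ω))
      + ξ := by
  rw [approx]
  congr 2
  exact Finset.sum_attach (Finset.Ico 1 n) (fun l : ℕ =>
    (t / (m : ℝ) ^ (n - l)) • ∑ k ∈ Finset.Icc 1 (m ^ (n - l)),
      (F (approx F ξ Z r l m (θ.child l k) (r (θ.child l k) ω * t) ω)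
          (Z (θ.child l k) ω)
        - F (approx F ξ Z r (l - 1) m (θ.child l (-k)) (r (θ.child l k) ω * t) ω)
          (Z (θ.child l k) ω)))

/-- Every family on `[0, T]` that satisfies the recursion (for `m ≥ 1`) is the one above. -/
theorem eq_approx {d : ℕ} {S Ω : Type*}
    (F : EuclideanSpace ℝ (Fin d) → S → EuclideanSpace ℝ (Fin d))
    (ξ : EuclideanSpace ℝ (Fin d)) (Z : Index → Ω → S) (r : Index → Ω → ℝ)
    (hr : ∀ θ ω, r θ ω ∈ Set.Icc (0 : ℝ) 1) (T : ℝ)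
    (Y : ℕ → ℕ → Index → ℝ → Ω → EuclideanSpace ℝ (Fin d))
    (hY : ∀ (n m : ℕ), 1 ≤ m → ∀ (θ : Index), ∀ t ∈ Set.Icc (0 : ℝ) T, ∀ ω, Y n m θ t ω =
      (∑ l ∈ Finset.Ico 1 n,
        (t / (m : ℝ) ^ (n - l)) • ∑ k ∈ Finset.Icc 1 (m ^ (n - l)),
          (F (Y l m (θ.child l k) (r (θ.child l k) ω * t) ω) (Z (θ.child l k) ω)
            - F (Y (l - 1) m (θ.child l (-k)) (r (θ.child l k) ω * t) ω) (Z (θ.child l k) ω)))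
      + ((if 1 ≤ n then t else 0) / (m : ℝ) ^ n) •
          (∑ k ∈ Finset.Icc 1 (m ^ n), F ξ (Z (θ.child 0 k) ω))
      + ξ)
    (n m : ℕ) (hm : 1 ≤ m) (θ : Index) (t : ℝ) (ht : t ∈ Set.Icc (0 : ℝ) T) (ω : Ω) :
    Y n m θ t ω = approx F ξ Z r n m θ t ω := by
  induction n using Nat.strong_induction_on generalizing θ t with
  | _ n ih =>
    rw [hY n m hm θ t ht ω, approx_eq]
    congr 2
    refine Finset.sum_congr rfl fun l hl => ?_
    have h := Finset.mem_Ico.1 hl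
    congr 1
    refine Finset.sum_congr rfl fun k _ => ?_
    have hs : r (θ.child l k) ω * t ∈ Set.Icc (0 : ℝ) T :=
      ⟨mul_nonneg (hr _ _).1 ht.1, (mul_le_of_le_one_left ht.1 (hr _ _).2).trans ht.2⟩
    rw [ih l h.2 _ _ hs, ih (l - 1) (by omega) _ _ hs]

/-- `X ∈ C([0,T], ℝᵈ)` satisfies `X(t) = ξ + ∫₀ᵗ E[F(X(r), ζ)] dr` for all `t ∈ [0,T]`.
(The projection `Set.projIcc` is the identity on `[0,T]`.) -/
def SolvesExpectationODE {d : ℕ} {S Ω : Type*} [MeasurableSpace Ω]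
    (F : EuclideanSpace ℝ (Fin d) → S → EuclideanSpace ℝ (Fin d))
    (ξ : EuclideanSpace ℝ (Fin d)) (P : Measure Ω) (ζ : Ω → S) {T : ℝ} (hT : 0 ≤ T)
    (X : C(Set.Icc (0 : ℝ) T, EuclideanSpace ℝ (Fin d))) : Prop :=
  ∀ t : Set.Icc (0 : ℝ) T,
    X t = ξ + ∫ r in (0 : ℝ)..t, ∫ ω, F (X (Set.projIcc 0 T hT r)) (ζ ω) ∂P

end MLP

/-!
All estimates are made for the Euclidean norm, to which the given norm is equivalent
(`exists_norm_equiv`); this only changes constants. The averaged right-hand side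
`x ↦ E[F(x, Z⁰)]` is globally Lipschitz, so some iterate of the Picard map is a contraction of
`C([0,T], ℝᵈ)`, which gives the unique solution `X` (`exists_unique_integral_equation`).

For the error, the approximation with index `θ` is one fixed measurable function `canon` of the
samples and random times whose index extends `θ` (`approx_eq_canon`), so that one may work with the
product law of an i.i.d. family. Two facts drive the error recursion
(`l2Bound_sub_canon_step`). First, the expectations of the corrections telescope, and a uniform
random time turns an average into a time integral; hence the bias at level `n` is at most `L` times
the `L²` error at level `n - 1`, integrated in time. Second, the summands of a level use disjoint
sets of samples and are independent, so that the fluctuation of the average of `m^(n-l)` of them is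
smaller by a factor `m^(-(n-l)/2)` (`L2Bound.sum_sub_integral`), while each of them is controlled
by the errors at levels `l` and `l - 1`. With the weight `exp (m t / 2)`, each time
integration gains `m^(-1/2)`, and induction gives the bound
`C (1 + 2 L √T)ⁿ m^(-n/2) exp (m t / 2)` for the error (`l2Bound_sub_canon`).

For `m = n` the error is thus at most `C Kⁿ n^(-n/2)`, whereas the cost is at most `(5 n)ⁿ`
(`cost_le`). Let `N ε` be the least threshold from which on the error bound is at most `ε`. Unless
`N ε = 1`, `ε` is smaller than the error bound at `N ε - 1`, and the product of the cost with the
power `2 + δ` of that bound stays bounded, because the factor `j^(-δj/2)` beats every exponential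
(`exists_cost_mul_error_le`).
-/

namespace MLP

/-! ### Bounds in `L²` -/

section L2

variable {α β E : Type*} [MeasurableSpace α] [MeasurableSpace β]
  [NormedAddCommGroup E] {μ : Measure α} {ν : Measure β} {f g : α → E} {a b : ℝ}

/-- `f` is square integrable and its `L²` norm is at most `c`. -/
def L2Bound (f : α → E) (μ : Measure α) (c : ℝ) : Prop :=
  MemLp f 2 μ ∧ lpNorm f 2 μ ≤ c

theorem L2Bound.nonneg (h : L2Bound f μ a) : 0 ≤ a := lpNorm_nonneg.trans h.2

theorem L2Bound.mono_const (h : L2Bound f μ a) (hab : a ≤ b) : L2Bound f μ b :=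
  ⟨h.1, h.2.trans hab⟩

theorem lpNorm_two_sq (hf : MemLp f 2 μ) : lpNorm f 2 μ ^ 2 = ∫ x, ‖f x‖ ^ 2 ∂μ := by
  rw [lpNorm_eq_integral_norm_rpow_toReal (by simp) (by simp) hf.1]
  simp only [ENNReal.toReal_ofNat, Real.rpow_two]
  rw [← Real.rpow_natCast _ 2, ← Real.rpow_mul (integral_nonneg fun _ => by positivity)]
  norm_num

theorem l2Bound_iff : L2Bound f μ a ↔ MemLp f 2 μ ∧ 0 ≤ a ∧ ∫ x, ‖f x‖ ^ 2 ∂μ ≤ a ^ 2 := by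
  refine and_congr_right fun hf => ?_
  rw [← lpNorm_two_sq hf]
  exact ⟨fun h => ⟨lpNorm_nonneg.trans h, pow_le_pow_left₀ lpNorm_nonneg h 2⟩,
    fun h => le_of_sq_le_sq h.2 h.1⟩

theorem L2Bound.sub (hf : L2Bound f μ a) (hg : L2Bound g μ b) :
    L2Bound (fun x => f x - g x) μ (a + b) :=
  ⟨hf.1.sub hg.1, (lpNorm_sub_le hf.1 (by norm_num)).trans (add_le_add hf.2 hg.2)⟩

theorem L2Bound.finset_sum {ι : Type*} {s : Finset ι} {f : ι → α → E} {a : ι → ℝ}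
    (hf : ∀ i ∈ s, L2Bound (f i) μ (a i)) :
    L2Bound (fun x => ∑ i ∈ s, f i x) μ (∑ i ∈ s, a i) := by
  have h : (fun x => ∑ i ∈ s, f i x) = ∑ i ∈ s, f i := by ext; simp
  rw [h]
  exact ⟨memLp_finsetSum' _ fun i hi => (hf i hi).1,
    (lpNorm_sum_le (fun i hi => (hf i hi).1) (by norm_num)).trans
      (Finset.sum_le_sum fun i hi => (hf i hi).2)⟩

theorem L2Bound.const_smul [NormedSpace ℝ E] (hf : L2Bound f μ a) {c : ℝ} (hc : 0 ≤ c) :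
    L2Bound (fun x => c • f x) μ (c * a) := by
  refine ⟨hf.1.const_smul c, ?_⟩
  have h := lpNorm_const_smul (p := 2) c f μ
  rw [show (fun x => c • f x) = c • f from rfl, h]
  simpa [abs_of_nonneg hc] using mul_le_mul_of_nonneg_left hf.2 hc

theorem L2Bound.of_norm_le {E' : Type*} [NormedAddCommGroup E'] {g : α → E'}
    (hf : L2Bound f μ a) (hg : AEStronglyMeasurable g μ) {c : ℝ} (hc : 0 ≤ c)
    (h : ∀ x, ‖g x‖ ≤ c * ‖f x‖) : L2Bound g μ (c * a) := by
  have hfc : L2Bound (fun x => c • ‖f x‖) μ (c * a) := by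
    refine L2Bound.const_smul ⟨hf.1.norm, ?_⟩ hc
    exact (lpNorm_norm hf.1.1 2).trans_le hf.2
  refine ⟨hfc.1.of_le hg (.of_forall fun x => (h x).trans (Real.le_norm_self _)),
    (lpNorm_mono_real hfc.1 h).trans hfc.2⟩

theorem L2Bound.comp_measurePreserving {f : β → E} (hf : L2Bound f ν a) {φ : α → β}
    (hφ : MeasurePreserving φ μ ν) : L2Bound (fun x => f (φ x)) μ a := by
  refine ⟨hf.1.comp_measurePreserving hφ, ?_⟩
  have := eLpNorm_comp_measurePreserving (p := 2) hf.1.1 hφ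
  change lpNorm (f ∘ φ) 2 μ ≤ a
  rw [← toReal_eLpNorm (hf.1.comp_measurePreserving hφ).1]
  refine (congrArg ENNReal.toReal this).trans_le ?_
  rw [toReal_eLpNorm hf.1.1]
  exact hf.2

theorem l2Bound_const [IsProbabilityMeasure μ] (x : E) : L2Bound (fun _ : α => x) μ ‖x‖ :=
  ⟨memLp_const x, by rw [lpNorm_const (by simp) (NeZero.ne μ)]; simp⟩

theorem L2Bound.norm_integral_le [NormedSpace ℝ E] [IsProbabilityMeasure μ]
    (hf : L2Bound f μ a) : ‖∫ x, f x ∂μ‖ ≤ a := by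
  refine (norm_integral_le_integral_norm f).trans ?_
  rw [← lpNorm_one_eq_integral_norm hf.1.1]
  refine le_trans ?_ hf.2
  rw [← toReal_eLpNorm hf.1.1, ← toReal_eLpNorm hf.1.1]
  exact ENNReal.toReal_mono hf.1.2.ne (eLpNorm_le_eLpNorm_of_exponent_le (by norm_num) hf.1.1)

/-- Tonelli's theorem for `L²` bounds of the sections. -/
theorem L2Bound.prod [SFinite μ] [SFinite ν] {f : α × β → E}
    (hf : AEStronglyMeasurable f (μ.prod ν)) {c : α → ℝ} (hc : Integrable (fun x => c x ^ 2) μ)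
    (h : ∀ᵐ x ∂μ, L2Bound (fun y => f (x, y)) ν (c x)) (ha : 0 ≤ a)
    (hca : ∫ x, c x ^ 2 ∂μ ≤ a ^ 2) : L2Bound f (μ.prod ν) a := by
  have hsq : AEStronglyMeasurable (fun p => ‖f p‖ ^ 2) (μ.prod ν) := hf.norm.pow 2
  have hle : ∀ᵐ x ∂μ, ∫ y, ‖f (x, y)‖ ^ 2 ∂ν ≤ c x ^ 2 := by
    filter_upwards [h] with x hx using (l2Bound_iff.1 hx).2.2
  have hint : Integrable (fun p => ‖f p‖ ^ 2) (μ.prod ν) := by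
    rw [integrable_prod_iff hsq]
    refine ⟨?_, ?_⟩
    · filter_upwards [h] with x hx using hx.1.integrable_norm_pow (by norm_num)
    · refine hc.mono' hsq.norm.integral_prod_right' ?_
      filter_upwards [hle] with x hx
      rw [Real.norm_of_nonneg (integral_nonneg fun _ => norm_nonneg _)]
      simpa using hx
  rw [l2Bound_iff]
  refine ⟨(memLp_two_iff_integrable_sq_norm hf).2 hint, ha, ?_⟩
  rw [integral_prod _ hint]
  exact (integral_mono_ae hint.integral_prod_left hc hle).trans hca

end L2

/-- The Monte Carlo estimate: for pairwise independent random variables with second moments at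
most `c²`, the fluctuation of a sum of `N` of them is of order `√N`. -/
theorem L2Bound.sum_sub_integral {Ω ι E : Type*} [MeasurableSpace Ω] {P : Measure Ω}
    [IsProbabilityMeasure P] [NormedAddCommGroup E] [InnerProductSpace ℝ E] [CompleteSpace E]
    [MeasurableSpace E] [BorelSpace E] {s : Finset ι} {X : ι → Ω → E} {c : ℝ} (hc : 0 ≤ c)
    (hX : ∀ i ∈ s, L2Bound (X i) P c)
    (hind : ∀ i ∈ s, ∀ j ∈ s, i ≠ j → IndepFun (X i) (X j) P) :
    L2Bound (fun ω => ∑ i ∈ s, (X i ω - ∫ ω', X i ω' ∂P)) P (Real.sqrt s.card * c) := by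
  set Y : ι → Ω → E := fun i ω => X i ω - ∫ ω', X i ω' ∂P with hY
  have hYm : ∀ i ∈ s, MemLp (Y i) 2 P := fun i hi => (hX i hi).1.sub (memLp_const _)
  have hXi : ∀ i ∈ s, Integrable (X i) P := fun i hi => (hX i hi).1.integrable (by norm_num)
  have hYi : ∀ i ∈ s, Integrable (Y i) P := fun i hi => (hYm i hi).integrable (by norm_num)
  have hY0 : ∀ i ∈ s, ∫ ω, Y i ω ∂P = 0 := fun i hi => by
    simp [hY, integral_sub (hXi i hi) (integrable_const _)]
  have hin : ∀ i ∈ s, ∀ j ∈ s, Integrable (fun ω => inner ℝ (Y i ω) (Y j ω)) P :=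
    fun i hi j hj =>
    ((hYm i hi).norm.integrable_mul (hYm j hj).norm).mono' ((hYm i hi).1.inner (hYm j hj).1)
      (.of_forall fun ω => norm_inner_le_norm _ _)
  have hoff : ∀ i ∈ s, ∀ j ∈ s, i ≠ j → ∫ ω, inner ℝ (Y i ω) (Y j ω) ∂P = 0 := by
    intro i hi j hj hij
    have hI : IndepFun (Y i) (Y j) P :=
      (hind i hi j hj hij).comp (φ := fun x => x - ∫ ω', X i ω' ∂P)
        (ψ := fun x => x - ∫ ω', X j ω' ∂P) (by fun_prop) (by fun_prop)
    have := hI.integral_bilin (hYi i hi) (hYi j hj) (innerSL ℝ)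
    rw [hY0 i hi, map_zero, zero_apply] at this
    exact this
  have hdiag : ∀ i ∈ s, ∫ ω, inner ℝ (Y i ω) (Y i ω) ∂P ≤ c ^ 2 := by
    intro i hi
    have h1 := (l2Bound_iff.1 (hX i hi)).2.2
    set e := ∫ ω', X i ω' ∂P with he
    have hsq : Integrable (fun ω => ‖X i ω‖ ^ 2) P :=
      (hX i hi).1.integrable_norm_pow (by norm_num)
    have h2 : ∀ ω, inner ℝ (Y i ω) (Y i ω) = ‖X i ω‖ ^ 2 - 2 * inner ℝ e (X i ω) + ‖e‖ ^ 2 := by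
      intro ω
      rw [real_inner_self_eq_norm_sq, hY]
      simp only
      rw [@norm_sub_sq_real, real_inner_comm]
    have h3 : ∫ ω, inner ℝ e (X i ω) ∂P = ‖e‖ ^ 2 := by
      rw [integral_inner (hXi i hi), ← he, real_inner_self_eq_norm_sq]
    simp_rw [h2]
    have hI : Integrable (fun ω => 2 * inner ℝ e (X i ω)) P :=
      ((hXi i hi).const_inner e).const_mul 2
    have hI' : Integrable (fun ω => ‖X i ω‖ ^ 2 - 2 * inner ℝ e (X i ω)) P := hsq.sub hI
    rw [integral_add hI' (integrable_const _), integral_sub hsq hI, integral_const_mul, h3]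
    simp only [integral_const, probReal_univ, one_smul]
    nlinarith [sq_nonneg ‖e‖]
  rw [l2Bound_iff]
  refine ⟨memLp_finsetSum _ hYm, by positivity, ?_⟩
  have hexp : ∀ ω, ‖∑ i ∈ s, Y i ω‖ ^ 2 = ∑ i ∈ s, ∑ j ∈ s, inner ℝ (Y i ω) (Y j ω) := by
    intro ω
    rw [← real_inner_self_eq_norm_sq, sum_inner]
    exact Finset.sum_congr rfl fun i _ => inner_sum _ _ _
  refine (integral_congr_ae (.of_forall hexp)).trans_le ?_
  rw [integral_finsetSum _ fun i hi => integrable_finsetSum _ fun j hj => hin i hi j hj]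
  calc _ = ∑ i ∈ s, ∫ ω, inner ℝ (Y i ω) (Y i ω) ∂P := by
        refine Finset.sum_congr rfl fun i hi => ?_
        rw [integral_finsetSum _ fun j hj => hin i hi j hj]
        exact Finset.sum_eq_single_of_mem i hi fun j hj hji => hoff i hi j hj hji.symm
    _ ≤ ∑ i ∈ s, c ^ 2 := Finset.sum_le_sum hdiag
    _ = _ := by rw [Finset.sum_const, mul_pow, Real.sq_sqrt (by positivity), nsmul_eq_mul]

/-! ### Independence of blocks of coordinates -/

theorem comap_block_le {Ω ι κ 𝓧 : Type*} [MeasurableSpace 𝓧] (X : ι → Ω → 𝓧) (f : κ → ι) :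
    MeasurableSpace.comap (fun ω i => X (f i) ω) MeasurableSpace.pi
      ≤ ⨆ i ∈ Set.range f, MeasurableSpace.comap (X i) inferInstance := by
  rw [MeasurableSpace.pi, MeasurableSpace.comap_iSup]
  refine iSup_le fun i => ?_
  rw [MeasurableSpace.comap_comp]
  exact le_iSup₂_of_le (f i) ⟨i, rfl⟩ le_rfl

/-- Blocks of an independent family with disjoint index sets are independent. -/
theorem indepFun_blocks {Ω ι κ κ' 𝓧 : Type*} [MeasurableSpace Ω] {P : Measure Ω}
    [MeasurableSpace 𝓧] {X : ι → Ω → 𝓧} (hX : ∀ i, Measurable (X i)) (hind : iIndepFun X P)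
    (f : κ → ι) (g : κ' → ι) (hfg : ∀ i j, f i ≠ g j) :
    IndepFun (fun ω i => X (f i) ω) (fun ω j => X (g j) ω) P := by
  have h := indep_iSup_of_disjoint (fun i => (hX i).comap_le) hind.iIndep
    (S := Set.range f) (T := Set.range g)
    (Set.disjoint_left.2 fun x ⟨i, hi⟩ ⟨j, hj⟩ => hfg i j (hi.trans hj.symm))
  exact indep_of_indep_of_le_right (indep_of_indep_of_le_left h (comap_block_le X f))
    (comap_block_le X g)

/-- Two independent families, each of independent random variables, combine to an independent
family of pairs. -/
theorem iIndepFun_prodMk {Ω ι 𝓧 𝓨 : Type*} [MeasurableSpace Ω] {P : Measure Ω}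
    [IsProbabilityMeasure P]
    [MeasurableSpace 𝓧] [MeasurableSpace 𝓨] {X : ι → Ω → 𝓧} {Y : ι → Ω → 𝓨}
    (hX : ∀ i, Measurable (X i)) (hY : ∀ i, Measurable (Y i)) (hXi : iIndepFun X P)
    (hYi : iIndepFun Y P) (hXY : IndepFun (fun ω i => X i ω) (fun ω i => Y i ω) P) :
    iIndepFun (fun i ω => (X i ω, Y i ω)) P := by
  classical
  let π : Set (Set (𝓧 × 𝓨)) := Set.image2 (· ×ˢ ·) {s | MeasurableSet s} {t | MeasurableSet t}
  refine iIndepSets.iIndep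
    (m := fun i => MeasurableSpace.comap (fun ω => (X i ω, Y i ω)) inferInstance)
    (fun i => ((hX i).prodMk (hY i)).comap_le)
    (fun i => {s | ∃ t ∈ π, (fun ω => (X i ω, Y i ω)) ⁻¹' t = s})
    (fun i => isPiSystem_prod.comap _) (fun i => ?_) ?_
  · rw [← generateFrom_prod, MeasurableSpace.comap_generateFrom]
    rfl
  · rw [iIndepSets_iff]
    intro s A hA
    have hA' : ∀ i, ∃ U : Set 𝓧, ∃ V : Set 𝓨, MeasurableSet U ∧ MeasurableSet V ∧
        (i ∈ s → A i = X i ⁻¹' U ∩ Y i ⁻¹' V) := by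
      intro i
      by_cases hi : i ∈ s
      · obtain ⟨_, ⟨U, hU, V, hV, rfl⟩, h⟩ := hA i hi
        exact ⟨U, V, hU, hV, fun _ => h.symm⟩
      · exact ⟨∅, ∅, .empty, .empty, fun h => absurd h hi⟩
    choose U V hU hV hUV using hA'
    have h1 : ⋂ i ∈ s, A i = (⋂ i ∈ s, X i ⁻¹' U i) ∩ ⋂ i ∈ s, Y i ⁻¹' V i := by
      ext ω
      simp only [Set.mem_iInter, Set.mem_inter_iff]
      refine ⟨fun h => ⟨fun i hi => ?_, fun i hi => ?_⟩, fun h i hi => ?_⟩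
      · have := h i hi; rw [hUV i hi] at this; exact this.1
      · have := h i hi; rw [hUV i hi] at this; exact this.2
      · rw [hUV i hi]; exact ⟨h.1 i hi, h.2 i hi⟩
    have hfin : ∀ (B : ι → Set 𝓧), (∀ i, MeasurableSet (B i)) →
        MeasurableSet (⋂ i ∈ s, {x : ι → 𝓧 | x i ∈ B i}) := fun B hB =>
      .biInter s.countable_toSet fun i _ => measurable_pi_apply i (hB i)
    have hfin' : ∀ (B : ι → Set 𝓨), (∀ i, MeasurableSet (B i)) →
        MeasurableSet (⋂ i ∈ s, {x : ι → 𝓨 | x i ∈ B i}) := fun B hB =>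
      .biInter s.countable_toSet fun i _ => measurable_pi_apply i (hB i)
    have h2 := hXY.measure_inter_preimage_eq_mul _ _ (hfin U hU) (hfin' V hV)
    simp only [Set.preimage_iInter, Set.preimage_ofPred_eq] at h2
    rw [h1]
    refine Eq.trans h2 ?_
    have h3 := hXi.measure_inter_preimage_eq_mul s (sets := U) fun i _ => hU i
    have h4 := hYi.measure_inter_preimage_eq_mul s (sets := V) fun i _ => hV i
    refine (congrArg₂ (· * ·) h3 h4).trans ?_
    rw [← Finset.prod_mul_distrib]
    refine Finset.prod_congr rfl fun i hi => ?_
    rw [hUV i hi]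
    exact ((hXY.comp (measurable_pi_apply i) (measurable_pi_apply i)).measure_inter_preimage_eq_mul
      _ _ (hU i) (hV i)).symm

/-! ### The approximations on the canonical product space -/

/-- The index `(l, k) ∈ ℤ² ⊆ Θ`. -/
def node (l k : ℤ) : Index := ⟨[l, k], by simp⟩

/-- The concatenation of a finite tuple and an index. -/
def concat (p : List ℤ) (η : Index) : Index := ⟨p ++ η.1, by simp [η.2]⟩

theorem concat_injective (p : List ℤ) : Function.Injective (concat p) := fun _ _ h =>
  Subtype.ext (List.append_cancel_left (congrArg Subtype.val h))

/-- The samples of `w` below the index `(l, k)`, with their indices taken relative to it. -/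
def subtree {S : Type*} (l k : ℤ) (w : Index → S) (η : Index) : S := w (concat [l, k] η)

theorem measurable_subtree {S : Type*} [MeasurableSpace S] (l k : ℤ) :
    Measurable (subtree (S := S) l k) :=
  measurable_pi_lambda _ fun _ => measurable_pi_apply _

section Canon

variable {d : ℕ} {S : Type*}

/-- The multilevel Picard approximation `𝒳_{n,m}(t)` as a function of the family of all samples
and random times below its index, which are indexed relative to it. -/
noncomputable def canon
    (F : EuclideanSpace ℝ (Fin d) → S → EuclideanSpace ℝ (Fin d))
    (ξ : EuclideanSpace ℝ (Fin d)) (m n : ℕ) (t : ℝ) (w : Index → S × ℝ) :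
    EuclideanSpace ℝ (Fin d) :=
  (∑ l ∈ (Finset.Ico 1 n).attach,
      (t / (m : ℝ) ^ (n - l.1)) • ∑ k ∈ Finset.Icc 1 (m ^ (n - l.1)),
        (F (canon F ξ m l.1 ((w (node l.1 k)).2 * t) (subtree l.1 k w)) (w (node l.1 k)).1
          - F (canon F ξ m (l.1 - 1) ((w (node l.1 k)).2 * t) (subtree l.1 (-k) w))
            (w (node l.1 k)).1))
    + ((if 1 ≤ n then t else 0) / (m : ℝ) ^ n) •
        (∑ k ∈ Finset.Icc 1 (m ^ n), F ξ (w (node 0 k)).1)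
    + ξ
termination_by n
decreasing_by
  all_goals
    have h := Finset.mem_Ico.1 l.2
    omega

variable (F : EuclideanSpace ℝ (Fin d) → S → EuclideanSpace ℝ (Fin d))
    (ξ : EuclideanSpace ℝ (Fin d)) (m : ℕ)

/-- The summand with index `(l, k)` in the level `l` correction of `canon`. -/
noncomputable def correction (l : ℕ) (t : ℝ) (k : ℕ) (w : Index → S × ℝ) :
    EuclideanSpace ℝ (Fin d) :=
  F (canon F ξ m l ((w (node l k)).2 * t) (subtree l k w)) (w (node l k)).1
    - F (canon F ξ m (l - 1) ((w (node l k)).2 * t) (subtree l (-k) w)) (w (node l k)).1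

theorem canon_eq (n : ℕ) (t : ℝ) (w : Index → S × ℝ) :
    canon F ξ m n t w =
      (∑ l ∈ Finset.Ico 1 n,
        (t / (m : ℝ) ^ (n - l)) • ∑ k ∈ Finset.Icc 1 (m ^ (n - l)), correction F ξ m l t k w)
      + ((if 1 ≤ n then t else 0) / (m : ℝ) ^ n) •
          (∑ k ∈ Finset.Icc 1 (m ^ n), F ξ (w (node 0 k)).1)
      + ξ := by
  rw [canon]
  congr 2
  exact Finset.sum_attach (Finset.Ico 1 n) (fun l : ℕ =>
    (t / (m : ℝ) ^ (n - l)) • ∑ k ∈ Finset.Icc 1 (m ^ (n - l)), correction F ξ m l t k w)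

theorem canon_zero (t : ℝ) (w : Index → S × ℝ) : canon F ξ m 0 t w = ξ := by
  rw [canon_eq]; simp

/-- The approximation with index `θ` is `canon`, applied to the samples below `θ`. Its law
therefore does not depend on `θ`. -/
theorem approx_eq_canon {Ω : Type*} (Z : Index → Ω → S) (r : Index → Ω → ℝ) (n : ℕ) (θ : Index)
    (t : ℝ) (ω : Ω) :
    approx F ξ Z r n m θ t ω =
      canon F ξ m n t fun η => (Z (concat θ.1 η) ω, r (concat θ.1 η) ω) := by
  induction n using Nat.strong_induction_on generalizing θ t with
  | _ n ih =>
    rw [approx_eq, canon_eq]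
    congr 2
    refine Finset.sum_congr rfl fun l hl => ?_
    have h := Finset.mem_Ico.1 hl
    congr 1
    refine Finset.sum_congr rfl fun k _ => ?_
    have hsub : ∀ j : ℤ, (fun η => (Z (concat (θ.child l j).1 η) ω,
        r (concat (θ.child l j).1 η) ω)) =
        subtree l j fun η => (Z (concat θ.1 η) ω, r (concat θ.1 η) ω) := by
      intro j
      funext η
      have : concat (θ.child l j).1 η = concat θ.1 (concat [(l : ℤ), j] η) :=
        Subtype.ext (by simp [concat, Index.child])
      simp only [subtree, this]
    rw [ih l h.2, ih (l - 1) (by omega), hsub, hsub]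
    rfl

variable [MeasurableSpace S] {F}

theorem measurable_canon (hF : Measurable (Function.uncurry F)) (n : ℕ) :
    Measurable fun p : ℝ × (Index → S × ℝ) => canon F ξ m n p.1 p.2 := by
  induction n using Nat.strong_induction_on with
  | _ n ih =>
    simp_rw [canon_eq, correction]
    have hpart : ∀ l' < n, ∀ (l k j : ℤ), Measurable fun p : ℝ × (Index → S × ℝ) =>
        F (canon F ξ m l' ((p.2 (node l k)).2 * p.1) (subtree l j p.2)) (p.2 (node l k)).1 := by
      intro l' hl' l k j
      have hn : Measurable fun p : ℝ × (Index → S × ℝ) => p.2 (node l k) :=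
        (measurable_pi_apply _).comp measurable_snd
      exact hF.comp (((ih l' hl').comp ((hn.snd.mul measurable_fst).prodMk
        ((measurable_subtree l j).comp measurable_snd))).prodMk hn.fst)
    refine Measurable.add (Measurable.add (Finset.measurable_fun_sum _ fun l hl => ?_) ?_)
      measurable_const
    · have h := Finset.mem_Ico.1 hl
      exact (measurable_fst.div_const _).smul (Finset.measurable_fun_sum _ fun k _ =>
        (hpart l h.2 _ _ _).sub (hpart (l - 1) (by omega) _ _ _))
    · have hc : Measurable fun p : ℝ × (Index → S × ℝ) => if 1 ≤ n then p.1 else 0 := by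
        split_ifs
        exacts [measurable_fst, measurable_const]
      refine (hc.div_const _).smul (Finset.measurable_fun_sum _ fun k _ => ?_)
      have hn : Measurable fun p : ℝ × (Index → S × ℝ) => p.2 (node 0 k) :=
        (measurable_pi_apply _).comp measurable_snd
      exact hF.comp (measurable_const.prodMk hn.fst)

theorem measurable_correction (hF : Measurable (Function.uncurry F)) (l : ℕ) (t : ℝ) (k : ℕ) :
    Measurable (correction F ξ m l t k) := by
  have hpart : ∀ (l' : ℕ) (j : ℤ), Measurable fun w : Index → S × ℝ =>
      F (canon F ξ m l' ((w (node l k)).2 * t) (subtree l j w)) (w (node l k)).1 := by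
    intro l' j
    have hn : Measurable fun w : Index → S × ℝ => w (node l k) := measurable_pi_apply _
    exact hF.comp (((measurable_canon ξ m hF l').comp ((hn.snd.mul_const t).prodMk
      (measurable_subtree l j))).prodMk hn.fst)
  exact (hpart l k).sub (hpart (l - 1) (-k))

end Canon

section Law

variable {S : Type*} [MeasurableSpace S] (μ : Measure S) [IsProbabilityMeasure μ]

/-- The law of an independent family of samples from `μ`. -/
noncomputable abbrev iidLaw : Measure (Index → S) := Measure.infinitePi fun _ : Index => μ

theorem iIndepFun_eval : iIndepFun (fun (i : Index) (w : Index → S) => w i) (iidLaw μ) :=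
  iIndepFun_infinitePi (P := fun _ : Index => μ) (X := fun _ x => x) fun _ => measurable_id

/-- The sample at `(l, k)` and the samples below `(l, j)` are independent and have their
canonical laws. -/
theorem measurePreserving_node_subtree (l k j : ℤ) :
    MeasurePreserving (fun w : Index → S => (w (node l k), subtree l j w)) (iidLaw μ)
      (μ.prod (iidLaw μ)) := by
  have hm : Measurable fun w : Index → S => w (node l k) := measurable_pi_apply _
  refine ⟨hm.prodMk (measurable_subtree l j), ?_⟩
  have hb := indepFun_blocks (fun i : Index => measurable_pi_apply i) (iIndepFun_eval μ)
    (fun _ : Unit => node l k) (concat [l, j]) (fun _ η h => η.2 (by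
      have := congrArg (fun x : Index => x.1.length) h
      simpa [node, concat] using this))
  have hI : IndepFun (fun w : Index → S => w (node l k)) (subtree l j) (iidLaw μ) :=
    hb.comp (φ := fun x : Unit → S => x ()) (ψ := id) (measurable_pi_apply _) measurable_id
  rw [hI.map_prod_eq_prod_map_map hm.aemeasurable (measurable_subtree l j).aemeasurable]
  congr 1
  · exact Measure.infinitePi_map_eval _ _
  · exact Measure.map_infinitePi_infinitePi_of_inj (P := fun _ : Index => μ)
      (concat_injective [l, j])

theorem measurePreserving_node (l k : ℤ) :
    MeasurePreserving (fun w : Index → S => w (node l k)) (iidLaw μ) μ :=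
  measurePreserving_eval_infinitePi (fun _ : Index => μ) _

end Law

/-- The corrections of one level are independent: they use disjoint sets of samples. -/
theorem indepFun_correction {d : ℕ} {S : Type*} [MeasurableSpace S]
    {F : EuclideanSpace ℝ (Fin d) → S → EuclideanSpace ℝ (Fin d)}
    (hF : Measurable (Function.uncurry F)) (ξ : EuclideanSpace ℝ (Fin d)) (m : ℕ)
    (μ : Measure (S × ℝ)) [IsProbabilityMeasure μ] (l : ℕ) (t : ℝ) {j k : ℕ} (hj : 1 ≤ j)
    (hk : 1 ≤ k) (hjk : j ≠ k) :
    IndepFun (correction F ξ m l t j) (correction F ξ m l t k) (iidLaw μ) := by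
  -- the samples used by the summand with index `(l, k)`
  let f : ℕ → Unit ⊕ Bool × Index → Index := fun k =>
    Sum.elim (fun _ => node l k) fun p => concat [(l : ℤ), if p.1 then (k : ℤ) else -k] p.2
  -- the second entry of each of their indices is `k` or `-k`
  have hkey : ∀ (k : ℕ) (i), ∃ u : ℤ, (u = k ∨ u = -k) ∧ (f k i).1[1]? = some u := by
    rintro k (i | ⟨b, η⟩)
    · exact ⟨k, .inl rfl, rfl⟩
    · cases b
      · exact ⟨-k, .inr rfl, rfl⟩
      · exact ⟨k, .inl rfl, rfl⟩
  have hb := indepFun_blocks (fun i : Index => measurable_pi_apply i) (iIndepFun_eval μ)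
    (f j) (f k) (fun a b h => by
      obtain ⟨u, hu, hu'⟩ := hkey j a
      obtain ⟨v, hv, hv'⟩ := hkey k b
      have : some u = some v := by rw [← hu', ← hv', h]
      have := Option.some.inj this
      omega)
  let G : (Unit ⊕ Bool × Index → S × ℝ) → EuclideanSpace ℝ (Fin d) := fun x =>
    F (canon F ξ m l ((x (.inl ())).2 * t) fun η => x (.inr (true, η))) (x (.inl ())).1
      - F (canon F ξ m (l - 1) ((x (.inl ())).2 * t) fun η => x (.inr (false, η))) (x (.inl ())).1
  have hG : Measurable G := by
    have hpart : ∀ (l' : ℕ) (b : Bool), Measurable fun x : Unit ⊕ Bool × Index → S × ℝ =>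
        F (canon F ξ m l' ((x (.inl ())).2 * t) fun η => x (.inr (b, η))) (x (.inl ())).1 := by
      intro l' b
      have hn : Measurable fun x : Unit ⊕ Bool × Index → S × ℝ => x (.inl ()) :=
        measurable_pi_apply _
      exact hF.comp (((measurable_canon ξ m hF l').comp ((hn.snd.mul_const t).prodMk
        (measurable_pi_lambda _ fun η => measurable_pi_apply _))).prodMk hn.fst)
    exact (hpart l true).sub (hpart (l - 1) false)
  exact hb.comp hG hG

/-! ### The error recursion -/

/-- The uniform distribution on `[0,1]`. -/
noncomputable abbrev unitLaw : Measure ℝ := volume.restrict (Set.Icc (0 : ℝ) 1)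

instance : IsProbabilityMeasure unitLaw := ⟨by simp⟩

theorem sum_Ico_one_sub_pred {E : Type*} [AddCommGroup E] (H : ℕ → E) {n : ℕ} (hn : 1 ≤ n) :
    ∑ l ∈ Finset.Ico 1 n, (H l - H (l - 1)) = H (n - 1) - H 0 := by
  induction n, hn using Nat.le_induction with
  | base => simp
  | succ n hn ih => rw [Finset.sum_Ico_succ_top hn, ih]; simp

theorem integral_eq_of_measurePreserving {α β E : Type*} [MeasurableSpace α] [MeasurableSpace β]
    [NormedAddCommGroup E] [NormedSpace ℝ E] {μ : Measure α} {ν : Measure β} {φ : α → β}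
    (hφ : MeasurePreserving φ μ ν) {f : β → E} (hf : AEStronglyMeasurable f ν) :
    ∫ x, f (φ x) ∂μ = ∫ y, f y ∂ν := by
  rw [← hφ.map_eq] at hf ⊢
  exact (integral_map hφ.measurable.aemeasurable hf).symm

section Error

variable {d : ℕ} {S : Type*} [MeasurableSpace S]
  {F : EuclideanSpace ℝ (Fin d) → S → EuclideanSpace ℝ (Fin d)}
  {ξ : EuclideanSpace ℝ (Fin d)} {L A : ℝ} {ν : Measure S} [IsProbabilityMeasure ν]

/-- Square integrability of `F ξ` and of `Y` passes to `F Y`, by Lipschitz continuity. -/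
theorem memLp_lipschitz_comp {α : Type*} [MeasurableSpace α] {μ : Measure α} [IsFiniteMeasure μ]
    (hF : Measurable (Function.uncurry F)) (hLip : ∀ x y s, ‖F x s - F y s‖ ≤ L * ‖x - y‖)
    {φ : α → S} (hφ : Measurable φ) (hξ : MemLp (fun a => F ξ (φ a)) 2 μ)
    {Y : α → EuclideanSpace ℝ (Fin d)} (hYm : Measurable Y) (hY : MemLp Y 2 μ) :
    MemLp (fun a => F (Y a) (φ a)) 2 μ := by
  have h1 : MemLp (fun a => F (Y a) (φ a) - F ξ (φ a)) 2 μ :=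
    (hY.sub (memLp_const ξ)).of_le_mul (c := L)
      ((hF.comp (hYm.prodMk hφ)).sub (hF.comp (measurable_const.prodMk hφ))).aestronglyMeasurable
      (.of_forall fun a => hLip _ _ _)
  have := h1.add hξ
  simpa [Pi.add_def] using this

theorem memLp_comp_mul {X : ℝ → EuclideanSpace ℝ (Fin d)} (hX : Continuous X) (t : ℝ) :
    MemLp (fun q : S × ℝ => X (q.2 * t)) 2 (ν.prod unitLaw) := by
  obtain ⟨B, hB⟩ := (isCompact_Icc (a := (0 : ℝ)) (b := 1)).exists_bound_of_continuousOn
    (f := fun u => X (u * t)) (by fun_prop)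
  have h : MemLp (fun u => X (u * t)) 2 unitLaw :=
    MemLp.of_bound (by fun_prop) B
      ((ae_restrict_iff' measurableSet_Icc).2 (.of_forall hB))
  exact h.comp_measurePreserving measurePreserving_snd

/-- One step of the error recursion. The bias of the approximation at level `n` is governed by the
error at level `n - 1`, since the expectations of the corrections telescope; the fluctuations are
controlled by the Monte Carlo estimate. -/
theorem l2Bound_sub_canon_step
    (hF : Measurable (Function.uncurry F)) (hL : 0 ≤ L)
    (hLip : ∀ x y s, ‖F x s - F y s‖ ≤ L * ‖x - y‖)
    (hA : L2Bound (fun s => F ξ s) ν A) {X : ℝ → EuclideanSpace ℝ (Fin d)} (hXc : Continuous X)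
    {m n : ℕ} (hm : 1 ≤ m) (hn : 1 ≤ n) {t : ℝ} (ht : 0 ≤ t)
    (hX : X t = ξ + ∫ s in (0 : ℝ)..t, ∫ z, F (X s) z ∂ν) {D : ℕ → ℝ}
    (hD : ∀ l < n, L2Bound (fun p : (S × ℝ) × (Index → S × ℝ) =>
        X (p.1.2 * t) - canon F ξ m l (p.1.2 * t) p.2)
      ((ν.prod unitLaw).prod (iidLaw (ν.prod unitLaw))) (D l)) :
    L2Bound (fun w => X t - canon F ξ m n t w) (iidLaw (ν.prod unitLaw))
      (t * (L * D (n - 1))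
        + ∑ l ∈ Finset.Ico 1 n, t / (m : ℝ) ^ (n - l) *
          (Real.sqrt ((m : ℝ) ^ (n - l)) * (L * (D l + D (l - 1))))
        + t / (m : ℝ) ^ n * (Real.sqrt ((m : ℝ) ^ n) * A)) := by
  set μ : Measure (S × ℝ) := ν.prod unitLaw with hμ
  set π : Measure (Index → S × ℝ) := iidLaw μ with hπ
  have hm0 : (0 : ℝ) < m := by exact_mod_cast hm
  have hφ : Measurable fun p : (S × ℝ) × (Index → S × ℝ) => p.1.1 := measurable_fst.fst
  have hfst : MeasurePreserving (fun p : (S × ℝ) × (Index → S × ℝ) => p.1.1) (μ.prod π) ν :=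
    measurePreserving_fst.comp measurePreserving_fst
  have hXm : Measurable fun p : (S × ℝ) × (Index → S × ℝ) => X (p.1.2 * t) :=
    hXc.measurable.comp (measurable_fst.snd.mul_const t)
  have hcm : ∀ l, Measurable fun p : (S × ℝ) × (Index → S × ℝ) =>
      canon F ξ m l (p.1.2 * t) p.2 := fun l =>
    (measurable_canon ξ m hF l).comp ((measurable_fst.snd.mul_const t).prodMk measurable_snd)
  have hξm : MemLp (fun p : (S × ℝ) × (Index → S × ℝ) => F ξ p.1.1) 2 (μ.prod π) :=
    hA.1.comp_measurePreserving hfst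
  have hXL : MemLp (fun p : (S × ℝ) × (Index → S × ℝ) => X (p.1.2 * t)) 2 (μ.prod π) :=
    (memLp_comp_mul hXc t).comp_measurePreserving measurePreserving_fst
  have hcL : ∀ l < n, MemLp (fun p : (S × ℝ) × (Index → S × ℝ) =>
      canon F ξ m l (p.1.2 * t) p.2) 2 (μ.prod π) := fun l hl => by
    have := hXL.sub (hD l hl).1
    simpa [Pi.sub_def] using this
  -- the expectations of `F` along the solution and along the approximations
  set HX := ∫ p : (S × ℝ) × (Index → S × ℝ), F (X (p.1.2 * t)) p.1.1 ∂(μ.prod π) with hHX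
  set H : ℕ → EuclideanSpace ℝ (Fin d) := fun l =>
    ∫ p : (S × ℝ) × (Index → S × ℝ), F (canon F ξ m l (p.1.2 * t) p.2) p.1.1 ∂(μ.prod π) with hH
  have hFX : MemLp (fun p : (S × ℝ) × (Index → S × ℝ) => F (X (p.1.2 * t)) p.1.1) 2 (μ.prod π) :=
    memLp_lipschitz_comp hF hLip hφ hξm hXm hXL
  have hFc : ∀ l < n, MemLp (fun p : (S × ℝ) × (Index → S × ℝ) =>
      F (canon F ξ m l (p.1.2 * t) p.2) p.1.1) 2 (μ.prod π) := fun l hl =>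
    memLp_lipschitz_comp hF hLip hφ hξm (hcm l) (hcL l hl)
  -- substitute `s = u t` in the integral equation
  have hXt : X t = ξ + t • HX := by
    have hg : MemLp (fun q : S × ℝ => F (X (q.2 * t)) q.1) 2 μ :=
      memLp_lipschitz_comp hF hLip measurable_fst
        (hA.1.comp_measurePreserving measurePreserving_fst)
        (hXc.measurable.comp (measurable_snd.mul_const t)) (memLp_comp_mul hXc t)
    have h1 : HX = ∫ q, F (X (q.2 * t)) q.1 ∂μ :=
      integral_eq_of_measurePreserving (f := fun q : S × ℝ => F (X (q.2 * t)) q.1)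
        measurePreserving_fst hg.1
    rw [hX, h1, hμ, integral_prod_symm _ (hg.integrable (by norm_num)),
      integral_Icc_eq_integral_Ioc, ← intervalIntegral.integral_of_le zero_le_one]
    have := intervalIntegral.smul_integral_comp_mul_right (a := 0) (b := 1)
      (fun s => ∫ z, F (X s) z ∂ν) t
    rw [this]
    simp
  have hcorr : ∀ l ∈ Finset.Ico 1 n, ∀ k, ∫ w, correction F ξ m l t k w ∂π = H l - H (l - 1) := by
    intro l hl k
    have h := Finset.mem_Ico.1 hl
    have h1 := (hFc l h.2).comp_measurePreserving (measurePreserving_node_subtree μ l k k)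
    have h2 := (hFc (l - 1) (by omega)).comp_measurePreserving
      (measurePreserving_node_subtree μ l k (-k))
    have h3 := integral_eq_of_measurePreserving (measurePreserving_node_subtree μ l k k)
      (hFc l h.2).1
    have h4 := integral_eq_of_measurePreserving (measurePreserving_node_subtree μ l k (-k))
      (hFc (l - 1) (by omega)).1
    refine Eq.trans ?_ (congrArg₂ (· - ·) h3 h4)
    exact integral_sub (h1.integrable (by norm_num)) (h2.integrable (by norm_num))
  have hcorrL : ∀ l ∈ Finset.Ico 1 n, ∀ k : ℕ,
      L2Bound (correction F ξ m l t k) π (L * (D l + D (l - 1))) := by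
    intro l hl k
    have h := Finset.mem_Ico.1 hl
    have h1 := (hD l h.2).comp_measurePreserving (measurePreserving_node_subtree μ l k k)
    have h2 := (hD (l - 1) (by omega)).comp_measurePreserving
      (measurePreserving_node_subtree μ l k (-k))
    refine (h1.sub h2).of_norm_le (measurable_correction ξ m hF l t k).aestronglyMeasurable hL
      fun w => (hLip _ _ _).trans_eq ?_
    rw [norm_sub_rev, sub_sub_sub_cancel_left]
  have hnode : ∀ k : ℕ, MeasurePreserving (fun w : Index → S × ℝ => (w (node 0 k)).1) π ν :=
    fun k => measurePreserving_fst.comp (measurePreserving_node μ 0 k)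
  have hH0 : ∀ k : ℕ, ∫ w : Index → S × ℝ, F ξ (w (node 0 k)).1 ∂π = H 0 := by
    intro k
    rw [integral_eq_of_measurePreserving (f := fun s => F ξ s) (hnode k) hA.1.1]
    simp only [hH, canon_zero]
    exact (integral_eq_of_measurePreserving (f := fun s => F ξ s) hfst hA.1.1).symm
  -- the bias, a deterministic quantity
  have hbias : L2Bound (fun _ : Index → S × ℝ => t • (HX - H (n - 1))) π
      (t * (L * D (n - 1))) := by
    have h1 : L2Bound (fun p : (S × ℝ) × (Index → S × ℝ) => F (X (p.1.2 * t)) p.1.1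
        - F (canon F ξ m (n - 1) (p.1.2 * t) p.2) p.1.1) (μ.prod π) (L * D (n - 1)) :=
      (hD (n - 1) (by omega)).of_norm_le (hFX.1.sub (hFc (n - 1) (by omega)).1) hL
        fun p => hLip _ _ _
    have h2 := h1.norm_integral_le
    rw [integral_sub (hFX.integrable (by norm_num))
      ((hFc (n - 1) (by omega)).integrable (by norm_num))] at h2
    exact (l2Bound_const _).mono_const (by
      rw [norm_smul, Real.norm_of_nonneg ht]; exact mul_le_mul_of_nonneg_left h2 ht)
  -- the fluctuations of the corrections and of the samples at `ξ`
  have hlevel : ∀ l ∈ Finset.Ico 1 n, L2Bound (fun w => (t / (m : ℝ) ^ (n - l)) •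
      ∑ k ∈ Finset.Icc 1 (m ^ (n - l)), (correction F ξ m l t k w - (H l - H (l - 1)))) π
      (t / (m : ℝ) ^ (n - l) * (Real.sqrt ((m : ℝ) ^ (n - l)) * (L * (D l + D (l - 1))))) := by
    intro l hl
    refine L2Bound.const_smul ?_ (by positivity)
    have := L2Bound.sum_sub_integral (s := Finset.Icc 1 (m ^ (n - l)))
      (hcorrL l hl 0).nonneg (fun k _ => hcorrL l hl k) fun i hi j hj hij =>
        indepFun_correction hF ξ m μ l t (Finset.mem_Icc.1 hi).1 (Finset.mem_Icc.1 hj).1 hij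
    simpa [hcorr l hl] using this
  have hbase : L2Bound (fun w : Index → S × ℝ => (t / (m : ℝ) ^ n) •
      ∑ k ∈ Finset.Icc 1 (m ^ n), (F ξ (w (node 0 k)).1 - H 0)) π
      (t / (m : ℝ) ^ n * (Real.sqrt ((m : ℝ) ^ n) * A)) := by
    refine L2Bound.const_smul ?_ (by positivity)
    have := L2Bound.sum_sub_integral (P := π) (s := Finset.Icc 1 (m ^ n))
      (X := fun (k : ℕ) w => F ξ (w (node 0 k)).1)
      hA.nonneg (fun k _ => hA.comp_measurePreserving (hnode k)) fun i _ j _ hij => by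
        have hne : node 0 (i : ℤ) ≠ node 0 (j : ℤ) := fun h => hij (by
          have := congrArg (fun x : Index => x.1[1]?) h
          simpa [node] using this)
        have hξ : Measurable fun q : S × ℝ => F ξ q.1 :=
          hF.comp (measurable_const.prodMk measurable_fst)
        exact ((iIndepFun_eval μ).indepFun hne).comp hξ hξ
    simpa [hH0] using this
  -- `X t - canon n t` is the bias minus the fluctuations, as the mean corrections telescope
  -- to `H (n - 1) - H 0`
  have hfinal := (hbias.sub (L2Bound.finset_sum hlevel)).sub hbase
  refine (congrArg (fun f => L2Bound f π _) (funext fun w => ?_)).mp hfinal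
  have hsum : ∀ (j : ℕ) (f : ℕ → EuclideanSpace ℝ (Fin d)) (c : EuclideanSpace ℝ (Fin d)),
      (t / (m : ℝ) ^ j) • ∑ k ∈ Finset.Icc 1 (m ^ j), (f k - c)
        = (t / (m : ℝ) ^ j) • ∑ k ∈ Finset.Icc 1 (m ^ j), f k - t • c := by
    intro j f c
    rw [Finset.sum_sub_distrib, smul_sub, Finset.sum_const, Nat.card_Icc, Nat.add_sub_cancel,
      ← Nat.cast_smul_eq_nsmul ℝ, smul_smul, Nat.cast_pow, div_mul_cancel₀ _ (by positivity)]
  simp_rw [hsum]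
  rw [Finset.sum_sub_distrib, ← Finset.smul_sum, sum_Ico_one_sub_pred H hn, canon_eq, hXt, if_pos hn]
  simp only [smul_sub]
  abel

/-- The error in the random times `𝔯 t`, which are uniformly distributed on `[0,t]`. -/
theorem l2Bound_sub_canon_randomTime (hF : Measurable (Function.uncurry F))
    {X : ℝ → EuclideanSpace ℝ (Fin d)} (hXc : Continuous X) {m l : ℕ} {T t a : ℝ}
    (ht : t ∈ Set.Icc 0 T) (ha : 0 ≤ a)
    (h : ∀ s ∈ Set.Icc 0 T, L2Bound (fun w => X s - canon F ξ m l s w)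
      (iidLaw (ν.prod unitLaw)) (a * Real.exp (m * s / 2))) :
    L2Bound (fun p : (S × ℝ) × (Index → S × ℝ) =>
        X (p.1.2 * t) - canon F ξ m l (p.1.2 * t) p.2)
      ((ν.prod unitLaw).prod (iidLaw (ν.prod unitLaw)))
      (a * Real.sqrt (∫ u in (0 : ℝ)..1, Real.exp (m * t * u))) := by
  have hI : 0 ≤ ∫ u in (0 : ℝ)..1, Real.exp (m * t * u) :=
    intervalIntegral.integral_nonneg zero_le_one fun _ _ => (Real.exp_pos _).le
  have hsq : ∀ x : S × ℝ, (a * Real.exp (m * (x.2 * t) / 2)) ^ 2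
      = a ^ 2 * Real.exp (m * t * x.2) := by
    intro x
    rw [mul_pow, ← Real.exp_nat_mul]
    congr 2
    push_cast
    ring
  have hint : Integrable (fun u => a ^ 2 * Real.exp (m * t * u)) unitLaw :=
    (Continuous.continuousOn (by fun_prop)).integrableOn_Icc
  refine L2Bound.prod (c := fun x : S × ℝ => a * Real.exp (m * (x.2 * t) / 2)) ?_ ?_ ?_
    (by positivity) ?_
  · exact ((hXc.measurable.comp (measurable_fst.snd.mul_const t)).sub
      ((measurable_canon ξ m hF l).comp ((measurable_fst.snd.mul_const t).prodMk
        measurable_snd))).aestronglyMeasurable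
  · simp_rw [hsq]
    exact hint.comp_snd ν
  · have h01 : ∀ᵐ u ∂unitLaw, u ∈ Set.Icc (0 : ℝ) 1 := ae_restrict_mem measurableSet_Icc
    filter_upwards [(measurePreserving_snd (μ := ν) (ν := unitLaw)).quasiMeasurePreserving.ae h01]
      with x hx
    exact h _ ⟨mul_nonneg hx.1 ht.1, (mul_le_of_le_one_left ht.1 hx.2).trans ht.2⟩
  · simp_rw [hsq]
    rw [integral_eq_of_measurePreserving (f := fun u => a ^ 2 * Real.exp (m * t * u))
      measurePreserving_snd hint.1, mul_pow, Real.sq_sqrt hI, integral_const_mul,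
      integral_Icc_eq_integral_Ioc, ← intervalIntegral.integral_of_le zero_le_one]

/-- The gain of `1 / √m` from one time integration of the weight `exp (m t)`. -/
theorem mul_sqrt_integral_exp_le {m t T : ℝ} (hm : 0 < m) (ht : t ∈ Set.Icc 0 T) :
    t * Real.sqrt (∫ u in (0 : ℝ)..1, Real.exp (m * t * u))
      ≤ Real.sqrt T * Real.exp (m * t / 2) / Real.sqrt m := by
  have hI : 0 ≤ ∫ u in (0 : ℝ)..1, Real.exp (m * t * u) :=
    intervalIntegral.integral_nonneg zero_le_one fun _ _ => (Real.exp_pos _).le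
  have h1 : m * t * ∫ u in (0 : ℝ)..1, Real.exp (m * t * u) = Real.exp (m * t) - 1 := by
    rw [intervalIntegral.mul_integral_comp_mul_left]
    simp
  have hT : 0 ≤ T := ht.1.trans ht.2
  rw [le_div_iff₀ (Real.sqrt_pos.2 hm)]
  refine le_of_sq_le_sq ?_ (by positivity)
  rw [mul_pow, mul_pow, mul_pow, Real.sq_sqrt hI, Real.sq_sqrt hm.le, Real.sq_sqrt hT,
    ← Real.exp_nat_mul]
  have h2 : ((2 : ℕ) : ℝ) * (m * t / 2) = m * t := by push_cast; ring
  rw [h2]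
  calc t ^ 2 * (∫ u in (0 : ℝ)..1, Real.exp (m * t * u)) * m
      = t * (m * t * ∫ u in (0 : ℝ)..1, Real.exp (m * t * u)) := by ring
    _ = t * (Real.exp (m * t) - 1) := by rw [h1]
    _ ≤ t * Real.exp (m * t) := mul_le_mul_of_nonneg_left (by linarith) ht.1
    _ ≤ T * Real.exp (m * t) := mul_le_mul_of_nonneg_right ht.2 (Real.exp_pos _).le

/-- The geometric sequence with ratio `1 + 2 q` is a supersolution of the error recursion. -/
theorem one_add_mul_sum_pow_le {q : ℝ} (hq : 0 ≤ q) {n : ℕ} (hn : 1 ≤ n) :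
    1 + q * ((1 + 2 * q) ^ (n - 1)
      + ∑ l ∈ Finset.Ico 1 n, ((1 + 2 * q) ^ l + (1 + 2 * q) ^ (l - 1))) ≤ (1 + 2 * q) ^ n := by
  induction n, hn using Nat.le_induction with
  | base => simp; linarith
  | succ n hn ih =>
    rw [Finset.sum_Ico_succ_top hn, pow_succ]
    simp only [Nat.add_sub_cancel]
    nlinarith

/-- The bounds `C κˡ s⁻ˡ e` with `κ = 1 + 2 L √T` are reproduced by the error recursion, where
`s = √m`, `e = exp (m t / 2)`, and `ρ` is the root mean square of the weight at the random time. -/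
theorem error_recursion_le {q C L T t A e ρ s : ℝ} (hq : q = L * Real.sqrt T) (hL : 0 ≤ L)
    (ht : t ∈ Set.Icc 0 T) (hA : 0 ≤ A) (hC : T * A ≤ C) (he : 1 ≤ e) (hs : 1 ≤ s)
    (htρ : t * ρ ≤ Real.sqrt T * e / s) {n : ℕ} (hn : 1 ≤ n) :
    t * (L * (C * (1 + 2 * q) ^ (n - 1) / s ^ (n - 1) * ρ))
      + ∑ l ∈ Finset.Ico 1 n, t / (s ^ 2) ^ (n - l) * (s ^ (n - l) *
          (L * (C * (1 + 2 * q) ^ l / s ^ l * ρ + C * (1 + 2 * q) ^ (l - 1) / s ^ (l - 1) * ρ)))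
      + t / (s ^ 2) ^ n * (s ^ n * A) ≤ C * (1 + 2 * q) ^ n / s ^ n * e := by
  have hs0 : 0 < s := by linarith
  have hT : 0 ≤ T := ht.1.trans ht.2
  have hC0 : 0 ≤ C := (mul_nonneg hT hA).trans hC
  have hq0 : 0 ≤ q := by rw [hq]; positivity
  have ht0 := ht.1
  have he0 : 0 ≤ e := by linarith
  set κ := 1 + 2 * q with hκ
  have hκ0 : 0 ≤ κ := by positivity
  have hLtρ : L * (t * ρ) ≤ q * e / s := by
    rw [hq]
    calc L * (t * ρ) ≤ L * (Real.sqrt T * e / s) := mul_le_mul_of_nonneg_left htρ hL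
      _ = _ := by ring
  have h1 : t * (L * (C * κ ^ (n - 1) / s ^ (n - 1) * ρ)) ≤ C * e / s ^ n * (q * κ ^ (n - 1)) := by
    calc t * (L * (C * κ ^ (n - 1) / s ^ (n - 1) * ρ))
        = (L * (t * ρ)) * (C * κ ^ (n - 1) / s ^ (n - 1)) := by ring
      _ ≤ (q * e / s) * (C * κ ^ (n - 1) / s ^ (n - 1)) :=
        mul_le_mul_of_nonneg_right hLtρ (by positivity)
      _ = C * e / (s ^ (n - 1) * s) * (q * κ ^ (n - 1)) := by field_simp
      _ = _ := by rw [← pow_succ, Nat.sub_add_cancel hn]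
  have h2 : ∀ l ∈ Finset.Ico 1 n, t / (s ^ 2) ^ (n - l) * (s ^ (n - l) *
      (L * (C * κ ^ l / s ^ l * ρ + C * κ ^ (l - 1) / s ^ (l - 1) * ρ)))
      ≤ C * e / s ^ n * (q * (κ ^ l + κ ^ (l - 1))) := by
    intro l hl
    obtain ⟨hl1, hl2⟩ := Finset.mem_Ico.1 hl
    have hsn : s ^ n = s ^ (n - l) * s ^ l := by rw [← pow_add, Nat.sub_add_cancel hl2.le]
    have hsl : s ^ l = s ^ (l - 1) * s := by rw [← pow_succ, Nat.sub_add_cancel hl1]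
    calc t / (s ^ 2) ^ (n - l) * (s ^ (n - l) *
          (L * (C * κ ^ l / s ^ l * ρ + C * κ ^ (l - 1) / s ^ (l - 1) * ρ)))
        = (L * (t * ρ)) * (C * (κ ^ l / s ^ l + κ ^ (l - 1) / s ^ (l - 1)) / s ^ (n - l)) := by
          rw [← pow_mul, mul_comm 2, pow_mul]; field_simp
      _ ≤ (q * e / s) * (C * (κ ^ l / s ^ l + κ ^ (l - 1) / s ^ (l - 1)) / s ^ (n - l)) :=
        mul_le_mul_of_nonneg_right hLtρ (by positivity)
      _ = C * e / s ^ n * (q * (κ ^ l / s + κ ^ (l - 1))) := by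
        rw [hsn, hsl]; field_simp
      _ ≤ _ := by
        gcongr
        exact div_le_self (by positivity) hs
  have h3 : t / (s ^ 2) ^ n * (s ^ n * A) ≤ C * e / s ^ n * 1 := by
    calc t / (s ^ 2) ^ n * (s ^ n * A) = t * A / s ^ n := by
          rw [← pow_mul, mul_comm 2, pow_mul]; field_simp
      _ ≤ C * e / s ^ n := by
        refine div_le_div_of_nonneg_right ?_ (by positivity)
        exact ((mul_le_mul_of_nonneg_right ht.2 hA).trans hC).trans (le_mul_of_one_le_right hC0 he)
      _ = _ := by ring
  refine (add_le_add (add_le_add h1 (Finset.sum_le_sum h2)) h3).trans ?_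
  rw [← Finset.mul_sum, ← Finset.mul_sum]
  calc _ = C * e / s ^ n * (1 + q * (κ ^ (n - 1)
        + ∑ l ∈ Finset.Ico 1 n, (κ ^ l + κ ^ (l - 1)))) := by ring
    _ ≤ C * e / s ^ n * κ ^ n :=
      mul_le_mul_of_nonneg_left (one_add_mul_sum_pow_le hq0 hn) (by positivity)
    _ = _ := by ring

/-- The error bound. The weight `exp (m t / 2)` turns each integration in time into
a factor `1 / √m`, which compensates for the smaller number of samples on the higher levels. -/
theorem l2Bound_sub_canon
    (hF : Measurable (Function.uncurry F)) (hL : 0 ≤ L)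
    (hLip : ∀ x y s, ‖F x s - F y s‖ ≤ L * ‖x - y‖)
    (hA : L2Bound (fun s => F ξ s) ν A) {X : ℝ → EuclideanSpace ℝ (Fin d)} (hXc : Continuous X)
    {T : ℝ} (hX : ∀ t ∈ Set.Icc 0 T, X t = ξ + ∫ s in (0 : ℝ)..t, ∫ z, F (X s) z ∂ν)
    {C : ℝ} (hCA : T * A ≤ C) (hCX : ∀ t ∈ Set.Icc 0 T, ‖X t - ξ‖ ≤ C) {m : ℕ} (hm : 1 ≤ m)
    (n : ℕ) {t : ℝ} (ht : t ∈ Set.Icc 0 T) :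
    L2Bound (fun w => X t - canon F ξ m n t w) (iidLaw (ν.prod unitLaw))
      (C * (1 + 2 * (L * Real.sqrt T)) ^ n / Real.sqrt m ^ n * Real.exp (m * t / 2)) := by
  have hC0 : 0 ≤ C := (norm_nonneg _).trans (hCX t ht)
  have hexp : ∀ t ∈ Set.Icc 0 T, 1 ≤ Real.exp (m * t / 2) := fun t ht => by
    have := ht.1
    exact Real.one_le_exp (by positivity)
  have hs : 1 ≤ Real.sqrt m := Real.one_le_sqrt.2 (by exact_mod_cast hm)
  induction n using Nat.strong_induction_on generalizing t with
  | _ n ih =>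
    rcases Nat.eq_zero_or_pos n with rfl | hn
    · simp only [canon_zero, pow_zero, mul_one, div_one]
      exact (l2Bound_const _).mono_const
        ((hCX t ht).trans (le_mul_of_one_le_right hC0 (hexp t ht)))
    · have hD := fun l (hl : l < n) => l2Bound_sub_canon_randomTime (ν := ν) hF hXc ht
        (a := C * (1 + 2 * (L * Real.sqrt T)) ^ l / Real.sqrt m ^ l) (by positivity)
        fun s hs => ih l hl hs
      refine (l2Bound_sub_canon_step hF hL hLip hA hXc hm hn ht.1 (hX t ht) hD).mono_const ?_
      have := error_recursion_le (n := n) rfl hL ht hA.nonneg hCA (hexp t ht) hs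
        (mul_sqrt_integral_exp_le (by exact_mod_cast hm) ht) hn
      rw [Real.sq_sqrt (Nat.cast_nonneg m)] at this
      have hpow : ∀ j, Real.sqrt ((m : ℝ) ^ j) = Real.sqrt m ^ j := fun j => by
        rw [Real.sqrt_eq_iff_eq_sq (by positivity) (by positivity), ← pow_mul, mul_comm, pow_mul,
          Real.sq_sqrt (Nat.cast_nonneg m)]
      simp_rw [hpow]
      exact this

end Error

/-! ### Cost against error -/

section Cost

theorem one_add_sum_three_mul_pow_le {n : ℕ} (hn : 1 ≤ n) :
    1 + ∑ l ∈ Finset.Ico 1 n, 3 * 5 ^ l ≤ 5 ^ n := by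
  induction n, hn using Nat.le_induction with
  | base => simp
  | succ n hn ih => rw [Finset.sum_Ico_succ_top hn, pow_succ]; omega

theorem cost_le {RV : ℕ → ℕ → ℕ} (hRV0 : ∀ m, 1 ≤ m → RV 0 m = 0)
    (hRV : ∀ n m, 1 ≤ n → 1 ≤ m →
      RV n m ≤ m ^ n + ∑ l ∈ Finset.Ico 1 n, m ^ (n - l) * (1 + RV l m + RV (l - 1) m))
    (n : ℕ) {m : ℕ} (hm : 1 ≤ m) : RV n m ≤ (5 * m) ^ n := by
  induction n using Nat.strong_induction_on with
  | _ n ih =>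
    rcases Nat.eq_zero_or_pos n with rfl | hn
    · simp [hRV0 m hm]
    · have h1 : ∀ l ∈ Finset.Ico 1 n,
          m ^ (n - l) * (1 + RV l m + RV (l - 1) m) ≤ m ^ n * (3 * 5 ^ l) := by
        intro l hl
        obtain ⟨hl1, hl2⟩ := Finset.mem_Ico.1 hl
        have h2 := ih l hl2
        have h3 := ih (l - 1) (by omega)
        have h4 : (5 * m) ^ (l - 1) ≤ (5 * m) ^ l := Nat.pow_le_pow_right (by omega) (by omega)
        have h5 : 1 ≤ (5 * m) ^ l := Nat.one_le_pow _ _ (by omega)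
        calc m ^ (n - l) * (1 + RV l m + RV (l - 1) m)
            ≤ m ^ (n - l) * (3 * (5 * m) ^ l) := Nat.mul_le_mul_left _ (by omega)
          _ = m ^ (n - l + l) * (3 * 5 ^ l) := by rw [pow_add, mul_pow]; ring
          _ = _ := by rw [Nat.sub_add_cancel hl2.le]
      calc RV n m ≤ m ^ n + ∑ l ∈ Finset.Ico 1 n, m ^ n * (3 * 5 ^ l) :=
            (hRV n m hn hm).trans (Nat.add_le_add_left (Finset.sum_le_sum h1) _)
        _ = m ^ n * (1 + ∑ l ∈ Finset.Ico 1 n, 3 * 5 ^ l) := by rw [← Finset.mul_sum]; ring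
        _ ≤ m ^ n * 5 ^ n := Nat.mul_le_mul_left _ (one_add_sum_three_mul_pow_le hn)
        _ = _ := by rw [mul_pow, mul_comm]

theorem sum_cost_le {R : ℕ → ℕ} (hR : ∀ n, 1 ≤ n → R n ≤ (5 * n) ^ n) (M : ℕ) :
    ∑ n ∈ Finset.Icc 1 M, R n ≤ (5 * M) ^ (M + 1) := by
  calc ∑ n ∈ Finset.Icc 1 M, R n ≤ ∑ n ∈ Finset.Icc 1 M, (5 * M) ^ M := by
        refine Finset.sum_le_sum fun n hn => ?_
        obtain ⟨h1, h2⟩ := Finset.mem_Icc.1 hn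
        exact (hR n h1).trans ((Nat.pow_le_pow_left (by omega) n).trans
          (Nat.pow_le_pow_right (by omega) h2))
    _ = M * (5 * M) ^ M := by simp
    _ ≤ (5 * M) * (5 * M) ^ M := Nat.mul_le_mul_right _ (by omega)
    _ = _ := by rw [pow_succ, mul_comm]

/-- The cost grows like `jʲ` and the error decays like `j^(-j/2)`, up to exponential factors. The
power `2 + δ` of the error therefore outweighs the cost: the surplus `j^(-δj/2)` absorbs
the exponential factors. -/
theorem exists_cost_mul_error_le {C K δ : ℝ} (hC : 0 < C) (hK : 0 < K) (hδ : 0 < δ) (p : ℕ) :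
    ∃ c, 0 ≤ c ∧ ∀ j : ℕ, 1 ≤ j →
      (5 * ((j : ℝ) + p)) ^ (j + p + 1) * (C * K ^ j / Real.sqrt j ^ j) ^ (2 + δ) ≤ c := by
  set a := Real.log (5 * (1 + p)) with ha
  have ha0 : 0 ≤ a := Real.log_nonneg (by have : (0 : ℝ) ≤ p := Nat.cast_nonneg p; linarith)
  set c₁ := a + (p + 1) + (2 + δ) * |Real.log K| with hc₁
  have hc₁0 : 0 ≤ c₁ := by positivity
  set c₂ := (p + 1) * a + (2 + δ) * |Real.log C| with hc₂
  refine ⟨Real.exp (c₂ + c₁ * Real.exp (2 * c₁ / δ)), (Real.exp_pos _).le, fun j hj => ?_⟩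
  have hj1 : (1 : ℝ) ≤ j := by exact_mod_cast hj
  have hj0 : (0 : ℝ) < j := by linarith
  have hp0 : (0 : ℝ) ≤ p := Nat.cast_nonneg p
  have hb : 0 < C * K ^ j / Real.sqrt j ^ j := by positivity
  have hlogj : 0 ≤ Real.log j := Real.log_nonneg hj1
  have hlogj' : Real.log j ≤ j := (Real.log_le_sub_one_of_pos hj0).trans (by linarith)
  -- with `log (5 (j + p)) ≤ a + log j` and `log j ≤ j`, the logarithm of the left-hand side is at
  -- most `c₂ + j (c₁ - (δ / 2) log j)`, whose second term is positive only if `j ≤ exp (2 c₁ / δ)`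
  rw [← Real.log_le_iff_le_exp (by positivity), Real.log_mul (by positivity) (by positivity),
    Real.log_pow, Real.log_rpow hb, Real.log_div (by positivity) (by positivity),
    Real.log_mul hC.ne' (by positivity), Real.log_pow, Real.log_pow,
    Real.log_sqrt hj0.le]
  have h1 : Real.log (5 * ((j : ℝ) + p)) ≤ a + Real.log j := by
    rw [ha, ← Real.log_mul (by positivity) (by positivity)]
    exact Real.log_le_log (by positivity) (by nlinarith)
  have h2 : ((j + p + 1 : ℕ) : ℝ) * Real.log (5 * ((j : ℝ) + p))
      ≤ (j + (p + 1)) * (a + Real.log j) := by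
    push_cast
    rw [add_assoc]
    exact mul_le_mul_of_nonneg_left h1 (by positivity)
  have h3 : (2 + δ) * Real.log C ≤ (2 + δ) * |Real.log C| :=
    mul_le_mul_of_nonneg_left (le_abs_self _) (by positivity)
  have h4 : (2 + δ) * (j * Real.log K) ≤ (2 + δ) * (j * |Real.log K|) := by
    gcongr; exact le_abs_self _
  have h5 : (p + 1) * Real.log j ≤ (p + 1) * (j : ℝ) := by gcongr
  have h6 : j * (c₁ - δ / 2 * Real.log j) ≤ c₁ * Real.exp (2 * c₁ / δ) := by
    rcases le_total (2 * c₁ / δ) (Real.log j) with h | h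
    · have : c₁ ≤ δ / 2 * Real.log j := by
        rw [div_le_iff₀ hδ] at h; linarith
      exact (mul_nonpos_of_nonneg_of_nonpos hj0.le (by linarith)).trans (by positivity)
    · have : (j : ℝ) ≤ Real.exp (2 * c₁ / δ) := (Real.log_le_iff_le_exp hj0).1 h
      calc j * (c₁ - δ / 2 * Real.log j) ≤ j * c₁ := by
            gcongr; linarith [mul_nonneg (half_pos hδ).le hlogj]
        _ ≤ Real.exp (2 * c₁ / δ) * c₁ := by gcongr
        _ = _ := mul_comm _ _
  calc _ ≤ (j + (p + 1)) * (a + Real.log j)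
        + ((2 + δ) * |Real.log C| + (2 + δ) * (j * |Real.log K|)
          - (2 + δ) * (j * (Real.log j / 2))) := by linarith
    _ = c₂ + (j * (a + (2 + δ) * |Real.log K| - δ / 2 * Real.log j)
          + (p + 1) * Real.log j) := by rw [hc₂]; ring
    _ ≤ c₂ + (j * (a + (2 + δ) * |Real.log K| - δ / 2 * Real.log j)
          + (p + 1) * (j : ℝ)) := by linarith
    _ = c₂ + j * (c₁ - δ / 2 * Real.log j) := by rw [hc₁]; ring
    _ ≤ _ := by linarith

theorem tendsto_error {C K : ℝ} (hC : 0 < C) (hK : 0 < K) :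
    Filter.Tendsto (fun n : ℕ => C * K ^ n / Real.sqrt n ^ n) Filter.atTop (nhds 0) := by
  have h1 : Filter.Tendsto (fun n : ℕ => C * (1 / 2 : ℝ) ^ n) Filter.atTop (nhds 0) := by
    simpa using (tendsto_pow_atTop_nhds_zero_of_lt_one (r := (1 / 2 : ℝ)) (by norm_num)
      (by norm_num)).const_mul C
  refine squeeze_zero' (.of_forall fun n => by positivity) ?_ h1
  filter_upwards [Filter.eventually_ge_atTop (max 1 ⌈(2 * K) ^ 2⌉₊)] with n hn
  have hn1 : (1 : ℝ) ≤ n := by exact_mod_cast (le_max_left _ _).trans hn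
  have hn2 : 2 * K ≤ Real.sqrt n :=
    Real.le_sqrt_of_sq_le ((Nat.le_ceil _).trans (by exact_mod_cast (le_max_right _ _).trans hn))
  have hs : 0 < Real.sqrt n := Real.sqrt_pos.2 (by linarith)
  rw [mul_div_assoc, ← div_pow]
  have : K / Real.sqrt n ≤ 1 / 2 := by rw [div_le_div_iff₀ hs two_pos]; linarith
  gcongr

/-- The least admissible threshold: if it is not `1`, then the bound fails directly below it. This
is what bounds `ε` from above in terms of the threshold. -/
theorem exists_threshold {b : ℕ → ℝ} (hb : Filter.Tendsto b Filter.atTop (nhds 0)) {ε : ℝ}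
    (hε : 0 < ε) : ∃ N, 1 ≤ N ∧ (∀ n, N ≤ n → b n ≤ ε) ∧ (2 ≤ N → ε < b (N - 1)) := by
  classical
  have hex : ∃ N, 1 ≤ N ∧ ∀ n, N ≤ n → b n ≤ ε := by
    obtain ⟨N, hN⟩ := Filter.eventually_atTop.1 (hb.eventually (ge_mem_nhds hε))
    exact ⟨max 1 N, le_max_left _ _, fun n hn => hN n ((le_max_right _ _).trans hn)⟩
  refine ⟨Nat.find hex, (Nat.find_spec hex).1, (Nat.find_spec hex).2, fun h2 => ?_⟩
  by_contra hlt
  refine Nat.find_min hex (m := Nat.find hex - 1) (by omega) ⟨by omega, fun n hn => ?_⟩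
  rcases hn.eq_or_lt with rfl | h
  · exact not_lt.1 hlt
  · exact (Nat.find_spec hex).2 n (by omega)

/-- A common threshold `N ε`, not depending on `δ`, for the error and for the cost. -/
theorem exists_cost_error {R : ℕ → ℕ} (hR : ∀ n, 1 ≤ n → R n ≤ (5 * n) ^ n) {C K : ℝ}
    (hC : 0 < C) (hK : 0 < K) (M : ℕ) :
    ∃ (c : ℝ → ℝ) (N : ℝ → ℕ), (∀ δ, 0 < δ → 0 ≤ c δ) ∧ (∀ ε, 0 < ε → ε ≤ 1 → 1 ≤ N ε) ∧
      ∀ δ ε : ℝ, 0 < δ → 0 < ε → ε ≤ 1 →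
        ((∑ n ∈ Finset.Icc 1 (N ε + M), R n : ℕ) : ℝ) ≤ c δ * ε ^ (-(2 + δ)) ∧
        ∀ n, N ε ≤ n → C * K ^ n / Real.sqrt n ^ n ≤ ε := by
  classical
  have hN : ∀ ε : ℝ, ∃ N, 0 < ε → 1 ≤ N ∧ (∀ n : ℕ, N ≤ n → C * K ^ n / Real.sqrt n ^ n ≤ ε) ∧
      (2 ≤ N → ε < C * K ^ (N - 1) / Real.sqrt (N - 1 : ℕ) ^ (N - 1)) := by
    intro ε
    by_cases hε : 0 < ε
    · obtain ⟨N, h⟩ := exists_threshold (tendsto_error hC hK) hε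
      exact ⟨N, fun _ => h⟩
    · exact ⟨0, fun h => absurd h hε⟩
  have hc : ∀ δ : ℝ, ∃ c, 0 < δ → 0 ≤ c ∧ ∀ j : ℕ, 1 ≤ j →
      (5 * ((j : ℝ) + (M + 1 : ℕ))) ^ (j + (M + 1) + 1)
        * (C * K ^ j / Real.sqrt j ^ j) ^ (2 + δ) ≤ c := by
    intro δ
    by_cases hδ : 0 < δ
    · obtain ⟨c, h⟩ := exists_cost_mul_error_le hC hK hδ (M + 1)
      exact ⟨c, fun _ => h⟩
    · exact ⟨0, fun h => absurd h hδ⟩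
  choose N hN using hN
  choose c hc using hc
  -- the additional constant accounts for those `ε` with `N ε = 1`
  set c₀ : ℝ := ((∑ n ∈ Finset.Icc 1 (1 + M), R n : ℕ) : ℝ) with hc₀
  have hc₀0 : 0 ≤ c₀ := Nat.cast_nonneg _
  refine ⟨fun δ => c δ + c₀, N, fun δ hδ => add_nonneg (hc δ hδ).1 hc₀0,
    fun ε hε _ => (hN ε hε).1, fun δ ε hδ hε hε1 => ⟨?_, (hN ε hε).2.1⟩⟩
  have hpos : 0 < ε ^ (-(2 + δ)) := Real.rpow_pos_of_pos hε _
  rcases (hN ε hε).1.eq_or_lt with h1 | h2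
  · rw [← h1]
    have h3 : 1 ≤ ε ^ (-(2 + δ)) :=
      Real.one_le_rpow_of_pos_of_le_one_of_nonpos hε hε1 (by linarith)
    have := (hc δ hδ).1
    nlinarith
  · have hlt := (hN ε hε).2.2 h2
    set j := N ε - 1 with hj
    have hNj : N ε + M = j + (M + 1) := by omega
    have h3 := (hc δ hδ).2 j (by omega)
    have h4 : ((∑ n ∈ Finset.Icc 1 (N ε + M), R n : ℕ) : ℝ)
        ≤ (5 * ((j : ℝ) + (M + 1 : ℕ))) ^ (j + (M + 1) + 1) := by
      rw [hNj]
      exact_mod_cast sum_cost_le hR (j + (M + 1))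
    have h5 : ε ^ (2 + δ) ≤ (C * K ^ j / Real.sqrt j ^ j) ^ (2 + δ) :=
      Real.rpow_le_rpow hε.le hlt.le (by linarith)
    have h6 : ((∑ n ∈ Finset.Icc 1 (N ε + M), R n : ℕ) : ℝ) * ε ^ (2 + δ) ≤ c δ :=
      (mul_le_mul h4 h5 (Real.rpow_nonneg hε.le _) (by positivity)).trans h3
    have h7 : 0 < ε ^ (2 + δ) := Real.rpow_pos_of_pos hε _
    rw [Real.rpow_neg hε.le, ← div_eq_mul_inv, le_div_iff₀ h7]
    linarith

end Cost

/-! ### The expectation ODE -/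

section ODE

variable {E : Type*} [NormedAddCommGroup E] [NormedSpace ℝ E] {T : ℝ}

/-- The Picard map `Y ↦ ξ + ∫₀ᵗ f(Y(r)) dr` on `C([0,T], E)`. -/
noncomputable def picardMap (ξ : E) {f : E → E} (hf : Continuous f) (hT : 0 ≤ T)
    (Y : C(Set.Icc (0 : ℝ) T, E)) : C(Set.Icc (0 : ℝ) T, E) where
  toFun t := ξ + ∫ r in (0 : ℝ)..t, f (Y (Set.projIcc 0 T hT r))
  continuous_toFun := by
    have h : Continuous fun r : ℝ => f (Y (Set.projIcc 0 T hT r)) :=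
      hf.comp (Y.continuous.comp continuous_projIcc)
    exact continuous_const.add ((intervalIntegral.continuous_primitive
      (fun a b => h.intervalIntegrable a b) 0).comp continuous_subtype_val)

theorem norm_picardMap_iterate_sub_le (ξ : E) {f : E → E} {K : NNReal} (hf : LipschitzWith K f)
    (hT : 0 ≤ T) (Y Y' : C(Set.Icc (0 : ℝ) T, E)) (n : ℕ) (t : Set.Icc (0 : ℝ) T) :
    ‖(picardMap ξ hf.continuous hT)^[n] Y t - (picardMap ξ hf.continuous hT)^[n] Y' t‖
      ≤ (K * t) ^ n / n.factorial * dist Y Y' := by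
  induction n generalizing t with
  | zero =>
    rw [← dist_eq_norm]
    simpa using ContinuousMap.dist_apply_le_dist (f := Y) (g := Y') t
  | succ n ih =>
    rw [Function.iterate_succ_apply', Function.iterate_succ_apply']
    set U := (picardMap ξ hf.continuous hT)^[n] Y with hU
    set U' := (picardMap ξ hf.continuous hT)^[n] Y' with hU'
    have hc : ∀ V : C(Set.Icc (0 : ℝ) T, E),
        Continuous fun r : ℝ => f (V (Set.projIcc 0 T hT r)) := fun V =>
      hf.continuous.comp (V.continuous.comp continuous_projIcc)
    have h1 : picardMap ξ hf.continuous hT U t - picardMap ξ hf.continuous hT U' t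
        = ∫ r in (0 : ℝ)..t, (f (U (Set.projIcc 0 T hT r)) - f (U' (Set.projIcc 0 T hT r))) := by
      rw [intervalIntegral.integral_sub ((hc U).intervalIntegrable _ _)
        ((hc U').intervalIntegrable _ _)]
      exact add_sub_add_left_eq_sub _ _ _
    rw [h1]
    have h2 : ∀ r ∈ Set.Ioc (0 : ℝ) t,
        ‖f (U (Set.projIcc 0 T hT r)) - f (U' (Set.projIcc 0 T hT r))‖
          ≤ K ^ (n + 1) / n.factorial * dist Y Y' * r ^ n := by
      intro r hr
      have hrT : r ∈ Set.Icc (0 : ℝ) T := ⟨hr.1.le, hr.2.trans t.2.2⟩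
      rw [Set.projIcc_of_mem hT hrT]
      calc _ ≤ K * ‖U ⟨r, hrT⟩ - U' ⟨r, hrT⟩‖ := hf.norm_sub_le _ _
        _ ≤ K * ((K * r) ^ n / n.factorial * dist Y Y') := by
          gcongr; exact ih ⟨r, hrT⟩
        _ = _ := by rw [mul_pow, pow_succ]; ring
    refine (intervalIntegral.norm_integral_le_of_norm_le t.2.1 (.of_forall h2)
      (Continuous.intervalIntegrable (by fun_prop) _ _)).trans_eq ?_
    rw [intervalIntegral.integral_const_mul, integral_pow, Nat.factorial_succ, mul_pow]
    push_cast
    have : (n.factorial : ℝ) ≠ 0 := by positivity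
    field_simp
    simp

/-- The global Picard–Lindelöf theorem on `[0,T]` for a globally Lipschitz right-hand side. -/
theorem exists_unique_integral_equation [CompleteSpace E] (ξ : E) {f : E → E} {K : NNReal}
    (hf : LipschitzWith K f) (hT : 0 ≤ T) :
    ∃ X : C(Set.Icc (0 : ℝ) T, E),
      (∀ t, X t = ξ + ∫ r in (0 : ℝ)..t, f (X (Set.projIcc 0 T hT r))) ∧
      ∀ Y : C(Set.Icc (0 : ℝ) T, E),
        (∀ t, Y t = ξ + ∫ r in (0 : ℝ)..t, f (Y (Set.projIcc 0 T hT r))) → Y = X := by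
  set Γ := picardMap ξ hf.continuous hT with hΓ
  obtain ⟨n, hn⟩ := ((FloorSemiring.tendsto_pow_div_factorial_atTop (K * T)).eventually
    (gt_mem_nhds zero_lt_one)).exists
  have h0 : 0 ≤ (K * T) ^ n / n.factorial := by positivity
  have hcon : ContractingWith ⟨_, h0⟩ Γ^[n] := by
    refine ⟨hn, LipschitzWith.of_dist_le_mul fun Y Y' => ?_⟩
    rw [ContinuousMap.dist_le (by positivity)]
    intro t
    rw [dist_eq_norm]
    refine (norm_picardMap_iterate_sub_le ξ hf hT Y Y' n t).trans ?_
    have := t.2.1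
    have := t.2.2
    change _ ≤ (K * T) ^ n / n.factorial * dist Y Y'
    gcongr
  refine ⟨_, fun t => (DFunLike.congr_fun hcon.isFixedPt_fixedPoint_iterate t).symm,
    fun Y hY => ?_⟩
  have hfix : Function.IsFixedPt Γ Y := ContinuousMap.ext fun t => (hY t).symm
  exact hcon.fixedPoint_unique (hfix.iterate n)

end ODE

/-! ### Norms, laws and the transfer to the given probability space -/

/-- A norm on a finite-dimensional space, given as a definite seminorm, is equivalent to
the norm of that space. -/
theorem exists_norm_equiv {E : Type*} [NormedAddCommGroup E] [NormedSpace ℝ E]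
    [FiniteDimensional ℝ E] (p : Seminorm ℝ E) (hp : ∀ x, p x = 0 → x = 0) :
    Continuous p ∧ ∃ a b : ℝ, 0 < a ∧ 0 < b ∧ ∀ x, ‖x‖ ≤ a * p x ∧ p x ≤ b * ‖x‖ := by
  have hcont : Continuous p := p.convexOn.locallyLipschitz.continuous
  obtain ⟨b, hb, hpb⟩ := p.bound_of_continuous_normedSpace hcont
  refine ⟨hcont, ?_⟩
  have hlow : ∃ a : ℝ, 0 < a ∧ ∀ x, ‖x‖ = 1 → 1 ≤ a * p x := by
    rcases (Metric.sphere (0 : E) 1).eq_empty_or_nonempty with h | h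
    · exact ⟨1, one_pos, fun x hx => absurd (by simpa using hx : x ∈ Metric.sphere (0 : E) 1)
        (by simp [h])⟩
    · obtain ⟨x₀, hx₀, hmin⟩ := (isCompact_sphere (0 : E) 1).exists_isMinOn h hcont.continuousOn
      have hpos : 0 < p x₀ := (apply_nonneg p x₀).lt_of_ne' fun h0 => by
        rw [hp x₀ h0] at hx₀
        simp at hx₀
      refine ⟨(p x₀)⁻¹, inv_pos.2 hpos, fun x hx => ?_⟩
      have : p x₀ ≤ p x := hmin (by simpa using hx)
      rwa [← div_eq_inv_mul, one_le_div hpos]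
  obtain ⟨a, ha, hpa⟩ := hlow
  refine ⟨a, b, ha, hb, fun x => ⟨?_, hpb x⟩⟩
  rcases eq_or_ne x 0 with rfl | hx
  · simp
  · have hn : 0 < ‖x‖ := norm_pos_iff.2 hx
    have h1 := hpa (‖x‖⁻¹ • x) (by rw [norm_smul, norm_inv, norm_norm, inv_mul_cancel₀ hn.ne'])
    rw [map_smul_eq_mul, norm_inv, norm_norm] at h1
    calc ‖x‖ = ‖x‖ * 1 := (mul_one _).symm
      _ ≤ ‖x‖ * (a * (‖x‖⁻¹ * p x)) := mul_le_mul_of_nonneg_left h1 hn.le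
      _ = a * p x := by field_simp

/-- The samples and random times below a given index have the law of the canonical family. -/
theorem measurePreserving_samples {S Ω : Type*} [MeasurableSpace S] [MeasurableSpace Ω]
    {P : Measure Ω} [IsProbabilityMeasure P]
    {Z : Index → Ω → S} (hZm : ∀ θ, Measurable (Z θ))
    (hZind : iIndepFun Z P) (hZid : ∀ θ θ', IdentDistrib (Z θ) (Z θ') P P)
    {r : Index → Ω → ℝ} (hrm : ∀ θ, Measurable (r θ))
    (hrind : iIndepFun r P) (hrunif : ∀ θ, pdf.IsUniform (r θ) (Set.Icc (0 : ℝ) 1) P volume)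
    (hrZ : IndepFun (fun ω θ => r θ ω) (fun ω θ => Z θ ω) P) (θ θ₀ : Index) :
    MeasurePreserving (fun ω η => (Z (concat θ.1 η) ω, r (concat θ.1 η) ω)) P
      (Measure.infinitePi fun _ : Index => (P.map (Z θ₀)).prod unitLaw) := by
  have hpair : ∀ η, Measurable fun ω => (Z η ω, r η ω) := fun η => (hZm η).prodMk (hrm η)
  have hind := (iIndepFun_prodMk hZm hrm hZind hrind hrZ.symm).precomp (concat_injective θ.1)
  refine ⟨measurable_pi_lambda _ fun η => hpair _, ?_⟩
  have hlaw : ∀ η, P.map (fun ω => (Z η ω, r η ω)) = (P.map (Z θ₀)).prod unitLaw := by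
    intro η
    have hI : IndepFun (Z η) (r η) P :=
      hrZ.symm.comp (φ := fun x : Index → S => x η) (ψ := fun x : Index → ℝ => x η)
        (measurable_pi_apply _) (measurable_pi_apply _)
    rw [hI.map_prod_eq_prod_map_map (hZm η).aemeasurable (hrm η).aemeasurable,
      (hZid η θ₀).map_eq]
    congr 1
    have := hrunif η
    rw [pdf.IsUniform] at this
    rw [this, ProbabilityTheory.cond]
    simp
  have h := hind.map_fun_eq_infinitePi_map fun η => hpair (concat θ.1 η)
  refine h.trans ?_
  congrm Measure.infinitePi fun η => ?_
  exact hlaw (concat θ.1 η)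

end MLP

open MLP in
theorem theorem3p5
    (d : ℕ) (hd : 1 ≤ d) (𝔑 : ℕ) (T L : ℝ) (hT : 0 ≤ T) (hL : 0 ≤ L)
    (ξ : EuclideanSpace ℝ (Fin d))
    -- an arbitrary norm on `ℝᵈ`
    (nrm : Seminorm ℝ (EuclideanSpace ℝ (Fin d))) (hnrm : ∀ x, nrm x = 0 → x = 0)
    {S : Type*} [MeasurableSpace S]
    (F : EuclideanSpace ℝ (Fin d) → S → EuclideanSpace ℝ (Fin d))
    (hF : Measurable (Function.uncurry F))
    (hLip : ∀ x y s, nrm (F x s - F y s) ≤ L * nrm (x - y))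
    {Ω : Type*} [MeasurableSpace Ω] (P : Measure Ω) [IsProbabilityMeasure P]
    -- i.i.d. random variables
    (Z : MLP.Index → Ω → S) (hZm : ∀ θ, Measurable (Z θ))
    (hZind : iIndepFun Z P) (hZid : ∀ θ θ', IdentDistrib (Z θ) (Z θ') P P)
    (hFξ : Integrable (fun ω => nrm (F ξ (Z MLP.Index.zero ω)) ^ 2) P)
    -- independent random variables, uniformly distributed on `[0,1]`
    (r : MLP.Index → Ω → ℝ) (hrm : ∀ θ, Measurable (r θ))
    (hr01 : ∀ θ ω, r θ ω ∈ Set.Icc (0 : ℝ) 1)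
    (hrind : iIndepFun r P) (hrunif : ∀ θ, pdf.IsUniform (r θ) (Set.Icc (0 : ℝ) 1) P volume)
    (hrZ : IndepFun (fun ω θ => r θ ω) (fun ω θ => Z θ ω) P)
    -- the computational cost
    (RV : ℕ → ℕ → ℕ) (hRV0 : ∀ m, 1 ≤ m → RV 0 m = 0)
    (hRV : ∀ n m, 1 ≤ n → 1 ≤ m →
      RV n m ≤ m ^ n + ∑ l ∈ Finset.Ico 1 n, m ^ (n - l) * (1 + RV l m + RV (l - 1) m)) :
    -- the integrals in the expectation ODE exist for every continuous function
    (∀ Y : C(Set.Icc (0 : ℝ) T, EuclideanSpace ℝ (Fin d)),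
      (∀ t, Integrable (fun ω => F (Y t) (Z MLP.Index.zero ω)) P) ∧
      IntervalIntegrable
        (fun t => ∫ ω, F (Y (Set.projIcc 0 T hT t)) (Z MLP.Index.zero ω) ∂P) volume 0 T) ∧
    ∃ X : C(Set.Icc (0 : ℝ) T, EuclideanSpace ℝ (Fin d)),
      -- (i) `X` is the unique continuous solution
      (MLP.SolvesExpectationODE F ξ P (Z MLP.Index.zero) hT X ∧
        ∀ Y, MLP.SolvesExpectationODE F ξ P (Z MLP.Index.zero) hT Y → Y = X) ∧
      -- (ii) cost and error
      ∃ (c : ℝ → ℝ) (N : ℝ → ℕ),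
        (∀ δ, 0 < δ → 0 ≤ c δ) ∧ (∀ ε, 0 < ε → ε ≤ 1 → 1 ≤ N ε) ∧
        ∀ δ ε : ℝ, 0 < δ → 0 < ε → ε ≤ 1 →
          ((∑ n ∈ Finset.Icc 1 (N ε + 𝔑), RV n n : ℕ) : ℝ) ≤ c δ * ε ^ (-(2 + δ)) ∧
          ∀ n, N ε ≤ n →
            Integrable (fun ω => nrm (X ⟨T, Set.right_mem_Icc.2 hT⟩
              - MLP.approx F ξ Z r n n MLP.Index.zero T ω) ^ 2) P ∧
            Real.sqrt (∫ ω, nrm (X ⟨T, Set.right_mem_Icc.2 hT⟩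
              - MLP.approx F ξ Z r n n MLP.Index.zero T ω) ^ 2 ∂P) ≤ ε := by
  obtain ⟨hcont, a, b, ha, hb, hab⟩ := exists_norm_equiv nrm hnrm
  set ν : Measure S := P.map (Z Index.zero) with hν
  have hνP : IsProbabilityMeasure ν := Measure.isProbabilityMeasure_map (hZm _).aemeasurable
  have hZν : MeasurePreserving (Z Index.zero) P ν := ⟨hZm _, rfl⟩
  -- in terms of the Euclidean norm, `F` is Lipschitz continuous with constant `a L b`
  have hLip' : ∀ x y s, ‖F x s - F y s‖ ≤ a * L * b * ‖x - y‖ := fun x y s =>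
    calc ‖F x s - F y s‖ ≤ a * nrm (F x s - F y s) := (hab _).1
      _ ≤ a * (L * (b * ‖x - y‖)) := by
        have := mul_le_mul_of_nonneg_left (hab (x - y)).2 hL
        exact mul_le_mul_of_nonneg_left ((hLip x y s).trans this) ha.le
      _ = _ := by ring
  have hL' : 0 ≤ a * L * b := by positivity
  have hFm : ∀ x, Measurable (F x) := fun x => hF.comp (measurable_const.prodMk measurable_id)
  have hFP : MemLp (fun ω => F ξ (Z Index.zero ω)) 2 P := by
    have hm : Measurable fun ω => F ξ (Z Index.zero ω) := (hFm ξ).comp (hZm _)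
    have h : MemLp (fun ω => nrm (F ξ (Z Index.zero ω))) 2 P :=
      (memLp_two_iff_integrable_sq (hcont.measurable.comp hm).aestronglyMeasurable).2 hFξ
    exact h.of_le_mul (c := a) hm.aestronglyMeasurable (.of_forall fun ω =>
      (hab _).1.trans (mul_le_mul_of_nonneg_left (Real.le_norm_self _) ha.le))
  have hFν : MemLp (fun s => F ξ s) 2 ν :=
    (memLp_map_measure_iff (hFm ξ).aestronglyMeasurable (hZm _).aemeasurable).2 hFP
  have hFi : ∀ x, Integrable (fun ω => F x (Z Index.zero ω)) P := fun x =>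
    (memLp_lipschitz_comp hF hLip' (hZm _) hFP measurable_const
      (memLp_const x)).integrable (by norm_num)
  set f : EuclideanSpace ℝ (Fin d) → EuclideanSpace ℝ (Fin d) :=
    fun x => ∫ ω, F x (Z Index.zero ω) ∂P with hf
  have hfν : ∀ x, f x = ∫ s, F x s ∂ν := fun x =>
    integral_eq_of_measurePreserving hZν (hFm x).aestronglyMeasurable
  have hfLip : LipschitzWith ⟨a * L * b, hL'⟩ f := by
    refine LipschitzWith.of_dist_le_mul fun x y => ?_
    rw [dist_eq_norm, dist_eq_norm, hf]
    simp only
    rw [← integral_sub (hFi x) (hFi y)]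
    exact (norm_integral_le_of_norm_le_const (.of_forall fun ω => hLip' x y _)).trans_eq
      (by rw [probReal_univ, mul_one]; rfl)
  refine ⟨fun Y => ⟨fun t => hFi _, Continuous.intervalIntegrable
    (hfLip.continuous.comp (Y.continuous.comp continuous_projIcc)) _ _⟩, ?_⟩
  obtain ⟨X, hX, hXu⟩ := exists_unique_integral_equation ξ hfLip hT
  refine ⟨X, ⟨hX, hXu⟩, ?_⟩
  set A := lpNorm (fun s => F ξ s) 2 ν with hA
  obtain ⟨C, hC0, hCA, hCX⟩ : ∃ C : ℝ, 0 < C ∧ T * A ≤ C ∧ ∀ t, ‖X t - ξ‖ ≤ C := by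
    refine ⟨max (T * A) ‖X - ContinuousMap.const _ ξ‖ + 1, ?_, ?_, fun t => ?_⟩
    · have := (norm_nonneg (X - ContinuousMap.const _ ξ)).trans (le_max_right (T * A) _)
      linarith
    · linarith [le_max_left (T * A) ‖X - ContinuousMap.const _ ξ‖]
    · have := ((X - ContinuousMap.const _ ξ).norm_coe_le_norm t).trans (le_max_right (T * A) _)
      exact this.trans (by linarith)
  -- at `n = m` the weight `exp (n T / 2)` is itself geometric and can be absorbed into `K ^ n`
  set K := (1 + 2 * (a * L * b * Real.sqrt T)) * Real.exp (T / 2) with hK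
  have hK0 : 0 < K := by positivity
  obtain ⟨c, N, hc, hN, hcN⟩ := exists_cost_error (R := fun n => RV n n)
    (fun n hn => cost_le hRV0 hRV n hn) (mul_pos hb hC0) hK0 𝔑
  refine ⟨c, N, hc, hN, fun δ ε hδ hε hε1 => ⟨(hcN δ ε hδ hε hε1).1, fun n hn => ?_⟩⟩
  have hn1 : 1 ≤ n := (hN ε hε hε1).trans hn
  have herr := (hcN δ ε hδ hε hε1).2 n hn
  have hTmem : T ∈ Set.Icc 0 T := Set.right_mem_Icc.2 hT
  have hcanon := l2Bound_sub_canon (ν := ν) (ξ := ξ) (X := fun t => X (Set.projIcc 0 T hT t))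
    hF hL' hLip' ⟨hFν, le_rfl⟩ (X.continuous.comp continuous_projIcc) (T := T)
    (fun t ht => by
      simp_rw [← hfν]
      rw [Set.projIcc_of_mem hT ht]
      exact hX ⟨t, ht⟩) hCA (fun t _ => hCX _) hn1 n hTmem
  have happrox := (hcanon.comp_measurePreserving (measurePreserving_samples hZm hZind hZid hrm
    hrind hrunif hrZ Index.zero Index.zero))
  simp only [← approx_eq_canon, Set.projIcc_of_mem hT hTmem] at happrox
  have hnrmL := happrox.of_norm_le (g := fun ω => nrm (X ⟨T, hTmem⟩
    - approx F ξ Z r n n Index.zero T ω))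
    (hcont.comp_aestronglyMeasurable happrox.1.1) hb.le fun ω => by
      rw [Real.norm_of_nonneg (apply_nonneg _ _)]
      exact (hab _).2
  have hbound : L2Bound (fun ω => nrm (X ⟨T, hTmem⟩
      - approx F ξ Z r n n Index.zero T ω)) P ε := by
    refine hnrmL.mono_const (le_trans (le_of_eq ?_) herr)
    have : Real.exp (n * T / 2) = Real.exp (T / 2) ^ n := by
      rw [← Real.exp_nat_mul, mul_div_assoc]
    rw [hK, mul_pow, this]
    ring
  refine ⟨hbound.1.integrable_sq, Real.sqrt_le_left hε.le |>.2 ?_⟩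
  simpa [sq_abs] using (l2Bound_iff.1 hbound).2.2
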